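/- Let $E=(E^0,E^1,r,s)$ be a finite directed graph with no sinks (every vertex is the source of at least one edge), with adjacency matrix $A=(n_{v,w})_{v,w\in E^0}$, where $n_{v,w}$ is the number of edges with source $v$ and range $w$, and let $K$ be a field. Let $\mathcal L(E)=\mathcal L_K(E)$ be the Leavitt path algebra, i.e. the $K$-algebra (with identity $\sum_{v\in E^0}v$) generated by the symbols $v\in E^0$ and $\alpha,\alpha^*$ for $\alpha\in E^1$, subject to $vw=\delta_{v,w}v$; $s(\alpha)\alpha=\alpha r(\alpha)=\alpha$ and $r(\alpha)\alpha^*=\alpha^*s(\alpha)=\alpha^*$; $\alpha^*\beta=\delta_{\alpha,\beta}\,r(\alpha)$; and $\sum_{s(\alpha)=v}\alpha\alpha^*=v$ for every vertex $v$. It is $\mathbb Z$-graded by $\deg v=0$, $\deg\alpha=1$, $\deg\alpha^*=-1$. Let $K_0^{\mathrm{gr}}(\mathcal L(E))$ be the group completion of the monoid $\mathcal V^{\mathrm{gr}}(\mathcal L(E))$ of graded isomorphism classes $[P]$ of graded finitely generated projective right $\mathcal L(E)$-modules under direct sum, let $K_0^{\mathrm{gr}}(\mathcal L(E))^+$ be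 the image of $\mathcal V^{\mathrm{gr}}(\mathcal L(E))$ in it, and give it the $\mathbb Z[x,x^{-1}]$-module structure with $x[P]=[P(1)]$, where $P(1)_i=P_{i+1}$. For a square nonnegative integer matrix $B$ of size $n$, let $\Delta_B$ be the direct limit of $\mathbb Z^n\xrightarrow{B}\mathbb Z^n\xrightarrow{B}\cdots$ (Krieger's dimension group); write $[a,k]$ for the class of a vector $a$ in the $k$-th copy of $\mathbb Z^n$, let $\Delta_B^+=\{[a,k] : a\in\mathbb N^n,\ k\ge 0\}$, and let $\delta_B$ be the automorphism $[a,k]\mapsto[Ba,k]$ of $\Delta_B$. Then there is a group isomorphism $\phi:K_0^{\mathrm{gr}}(\mathcal L(E))\to\Delta_{A^t}$ such that $\phi(x\alpha)=\delta_{A^t}(\phi(\alpha))$ for all $\alpha\in K_0^{\mathrm{gr}}(\mathcal L(E))$, and $\phi\big(K_0^{\mathrm{gr}}(\mathcal L(E))^+\big)=\Delta_{A^t}^+$. -/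

import Mathlib

open scoped LaurentPolynomial DirectSum Matrix

universe u v w x y

/-! ### Graded right modules over a graded ring -/

section GradedModules

theorem isInternal_of_subsingleton {Γ : Type x} [DecidableEq Γ] {M : Type*} [AddCommGroup M]
    [Subsingleton M] (P : Γ → AddSubgroup M) : DirectSum.IsInternal P :=
  ⟨fun _ _ _ => DFinsupp.ext fun _ => Subsingleton.elim _ _,
    fun _ => ⟨0, Subsingleton.elim _ _⟩⟩

theorem coeAddMonoidHom_map_of_comm {Γ : Type x} [DecidableEq Γ] {M N : Type*} [AddCommGroup M] [AddCommGroup N]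
    {P : Γ → AddSubgroup M} {Q : Γ → AddSubgroup N} (F : M →+ N) (f : ∀ i, P i →+ Q i)
    (h : ∀ i (p : P i), (f i p : N) = F p) (z : ⨁ i, P i) :
    DirectSum.coeAddMonoidHom Q (DirectSum.map f z) = F (DirectSum.coeAddMonoidHom P z) := by
  have : (DirectSum.coeAddMonoidHom Q).comp (DirectSum.map f) =
      F.comp (DirectSum.coeAddMonoidHom P) := by
    refine DirectSum.addHom_ext fun i p => ?_
    simp [h]
  exact DFunLike.congr_fun this z

variable {Γ : Type x} [AddCommGroup Γ] [DecidableEq Γ]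
variable {A : Type u} [Ring A] {σ : Type y} [SetLike σ A] [AddSubgroupClass σ A]

/-- A `Γ`-graded right module over the `Γ`-graded ring `A = ⨁ 𝒜 γ`: a right `A`-module
(that is, a module over `Aᵐᵒᵖ`; `op a • m` is `m a`) which is the internal direct sum of additive
subgroups `M_γ` such that `M_i A_j ⊆ M_{i+j}`. -/
structure GrModule (𝒜 : Γ → σ) [GradedRing 𝒜] where
  carrier : Type u
  [addCommGroup : AddCommGroup carrier]
  [module : Module Aᵐᵒᵖ carrier]
  deg : Γ → AddSubgroup carrier
  isInternal : DirectSum.IsInternal deg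
  smul_mem : ∀ {i j : Γ} {m : carrier} {a : A},
    m ∈ deg i → a ∈ 𝒜 j → MulOpposite.op a • m ∈ deg (i + j)

attribute [instance] GrModule.addCommGroup GrModule.module

namespace GrModule

variable {𝒜 : Γ → σ} [GradedRing 𝒜]

/-- A homomorphism of graded modules: an `A`-linear map preserving degrees. -/
def IsGradedHom {M N : GrModule 𝒜} (f : M.carrier →ₗ[Aᵐᵒᵖ] N.carrier) : Prop :=
  ∀ (i : Γ) (m : M.carrier), m ∈ M.deg i → f m ∈ N.deg i

/-- Graded isomorphism: there is a bijective graded homomorphism. -/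
def IsIso (M N : GrModule 𝒜) : Prop :=
  ∃ e : M.carrier ≃ₗ[Aᵐᵒᵖ] N.carrier, IsGradedHom (M := M) (N := N) e.toLinearMap

/-- Finitely generated graded modules. -/
def IsFG (M : GrModule 𝒜) : Prop := Module.Finite Aᵐᵒᵖ M.carrier

/-- Graded projective modules: the projective objects of the category of graded right modules,
i.e. graded homomorphisms out of `P` lift along surjective graded homomorphisms. -/
def IsGradedProjective (P : GrModule 𝒜) : Prop :=
  ∀ (M N : GrModule 𝒜) (g : M.carrier →ₗ[Aᵐᵒᵖ] N.carrier) (j : P.carrier →ₗ[Aᵐᵒᵖ] N.carrier),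
    IsGradedHom g → Function.Surjective g → IsGradedHom j →
      ∃ h : P.carrier →ₗ[Aᵐᵒᵖ] M.carrier, IsGradedHom h ∧ g ∘ₗ h = j

theorem IsIso.refl (M : GrModule 𝒜) : IsIso M M :=
  ⟨LinearEquiv.refl _ _, fun _ _ h => h⟩

theorem isGradedHom_symm {M N : GrModule 𝒜} (e : M.carrier ≃ₗ[Aᵐᵒᵖ] N.carrier)
    (he : IsGradedHom (M := M) (N := N) e.toLinearMap) :
    IsGradedHom (M := N) (N := M) e.symm.toLinearMap := by
  intro i n hn
  obtain ⟨z, hz⟩ := M.isInternal.2 (e.symm n)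
  let f : ∀ k, M.deg k →+ N.deg k := fun k =>
    ((e : M.carrier →+ N.carrier).comp (M.deg k).subtype).codRestrict (N.deg k)
      fun p => he k p p.2
  have h1 := coeAddMonoidHom_map_of_comm (e : M.carrier →+ N.carrier) f (fun _ _ => rfl) z
  rw [hz] at h1
  have h2 : DirectSum.map f z = DirectSum.of (fun k => N.deg k) i ⟨n, hn⟩ := by
    apply N.isInternal.1
    rw [h1]
    simp
  have h3 : z = DirectSum.of (fun k => M.deg k) i (z i) := by
    ext k : 1
    by_cases hk : k = i
    · subst hk
      simp
    · rw [DirectSum.of_eq_of_ne _ _ _ hk]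
      have h4 := congrArg (fun t => (t k : N.carrier)) h2
      simp only [DirectSum.map_apply] at h4
      rw [DirectSum.of_eq_of_ne _ _ _ hk] at h4
      have h5 : e (z k : M.carrier) = 0 := h4
      exact Subtype.ext (by simpa using h5)
  have h6 : e.symm n = (z i : M.carrier) := by
    rw [← hz, h3]
    simp
  change e.symm n ∈ M.deg i
  rw [h6]
  exact (z i).2

theorem IsIso.symm {M N : GrModule 𝒜} : IsIso M N → IsIso N M := fun ⟨e, he⟩ =>
  ⟨e.symm, isGradedHom_symm e he⟩

theorem IsIso.trans {M N P : GrModule 𝒜} : IsIso M N → IsIso N P → IsIso M P :=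
  fun ⟨e, he⟩ ⟨f, hf⟩ => ⟨e.trans f, fun i m hm => hf i _ (he i m hm)⟩

/-- The zero graded module. -/
def zero (𝒜 : Γ → σ) [GradedRing 𝒜] : GrModule 𝒜 where
  carrier := PUnit.{u + 1}
  deg _ := ⊥
  isInternal := isInternal_of_subsingleton _
  smul_mem _ _ := Subsingleton.elim _ _

/-- The direct sum `M ⊕ N`, with `(M ⊕ N)_γ = M_γ ⊕ N_γ`. -/
def prod (M N : GrModule 𝒜) : GrModule 𝒜 where
  carrier := M.carrier × N.carrier
  deg i := (M.deg i).prod (N.deg i)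
  isInternal := by
    let f₁ : ∀ k, ((M.deg k).prod (N.deg k)) →+ M.deg k := fun k =>
      ((AddMonoidHom.fst _ _).comp ((M.deg k).prod (N.deg k)).subtype).codRestrict (M.deg k)
        fun p => p.2.1
    let f₂ : ∀ k, ((M.deg k).prod (N.deg k)) →+ N.deg k := fun k =>
      ((AddMonoidHom.snd _ _).comp ((M.deg k).prod (N.deg k)).subtype).codRestrict (N.deg k)
        fun p => p.2.2
    let g₁ : ∀ k, M.deg k →+ ((M.deg k).prod (N.deg k)) := fun k =>
      ((AddMonoidHom.inl M.carrier N.carrier).comp (M.deg k).subtype).codRestrict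
        ((M.deg k).prod (N.deg k)) fun p => ⟨p.2, (N.deg k).zero_mem⟩
    let g₂ : ∀ k, N.deg k →+ ((M.deg k).prod (N.deg k)) := fun k =>
      ((AddMonoidHom.inr M.carrier N.carrier).comp (N.deg k).subtype).codRestrict
        ((M.deg k).prod (N.deg k)) fun p => ⟨(M.deg k).zero_mem, p.2⟩
    constructor
    · intro a b hab
      have h1 : DirectSum.map f₁ a = DirectSum.map f₁ b := by
        apply M.isInternal.1
        rw [coeAddMonoidHom_map_of_comm (AddMonoidHom.fst M.carrier N.carrier) f₁
            (fun _ _ => rfl), hab,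
          ← coeAddMonoidHom_map_of_comm (AddMonoidHom.fst M.carrier N.carrier) f₁
            (fun _ _ => rfl)]
      have h2 : DirectSum.map f₂ a = DirectSum.map f₂ b := by
        apply N.isInternal.1
        rw [coeAddMonoidHom_map_of_comm (AddMonoidHom.snd M.carrier N.carrier) f₂
            (fun _ _ => rfl), hab,
          ← coeAddMonoidHom_map_of_comm (AddMonoidHom.snd M.carrier N.carrier) f₂
            (fun _ _ => rfl)]
      ext i : 1
      have h3 := congrArg (fun t => (t i : M.carrier)) h1
      have h4 := congrArg (fun t => (t i : N.carrier)) h2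
      simp only [DirectSum.map_apply] at h3 h4
      exact Subtype.ext (Prod.ext h3 h4)
    · rintro ⟨m, n⟩
      obtain ⟨a, ha⟩ := M.isInternal.2 m
      obtain ⟨b, hb⟩ := N.isInternal.2 n
      refine ⟨DirectSum.map g₁ a + DirectSum.map g₂ b, ?_⟩
      rw [map_add, coeAddMonoidHom_map_of_comm (AddMonoidHom.inl M.carrier N.carrier) g₁
          (fun _ _ => rfl),
        coeAddMonoidHom_map_of_comm (AddMonoidHom.inr M.carrier N.carrier) g₂
          (fun _ _ => rfl), ha, hb]
      simp
  smul_mem hm ha := ⟨M.smul_mem hm.1 ha, N.smul_mem hm.2 ha⟩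

/-- The shifted module `M(δ)`, with `M(δ)_γ = M_{δ+γ}`. -/
def shift (δ : Γ) (M : GrModule 𝒜) : GrModule 𝒜 where
  carrier := M.carrier
  deg γ := M.deg (δ + γ)
  isInternal := by
    let e : (⨁ i, M.deg i) ≃+ ⨁ γ, M.deg (δ + γ) :=
      DirectSum.equivCongrLeft (β := fun i => M.deg i) (Equiv.addLeft δ).symm
    have he : ∀ (k : Γ) (p : M.deg (δ + k)), e (DirectSum.of (fun i => M.deg i) (δ + k) p) =
        DirectSum.of (fun γ => M.deg (δ + γ)) k p := fun k p =>
      DirectSum.equivCongrLeft_of (β := fun i => M.deg i) (Equiv.addLeft δ).symm k p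
    have h : (DirectSum.coeAddMonoidHom fun γ => M.deg (δ + γ)).comp e.toAddMonoidHom =
        DirectSum.coeAddMonoidHom M.deg := by
      refine DirectSum.addHom_ext fun i p => ?_
      obtain ⟨k, rfl⟩ := (Equiv.addLeft δ).surjective i
      have h1 (p : M.deg (δ + k)) : DirectSum.coeAddMonoidHom (fun γ => M.deg (δ + γ))
          (e (DirectSum.of (fun i => M.deg i) (δ + k) p)) =
          DirectSum.coeAddMonoidHom M.deg (DirectSum.of (fun i => M.deg i) (δ + k) p) := by
        rw [he, DirectSum.coeAddMonoidHom_of, DirectSum.coeAddMonoidHom_of]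
      exact h1 p
    have h' : (DirectSum.coeAddMonoidHom fun γ => M.deg (δ + γ)) ∘ e =
        DirectSum.coeAddMonoidHom M.deg := congrArg DFunLike.coe h
    have hb := M.isInternal
    unfold DirectSum.IsInternal at hb ⊢
    rw [← h'] at hb
    exact (Function.Bijective.of_comp_iff _ e.bijective).1 hb
  smul_mem hm ha := by
    rw [← add_assoc]
    exact M.smul_mem hm ha

theorem isFG_zero : (zero 𝒜).IsFG := inferInstanceAs (Module.Finite Aᵐᵒᵖ PUnit.{u + 1})

theorem IsFG.prod {M N : GrModule 𝒜} (hM : M.IsFG) (hN : N.IsFG) : (M.prod N).IsFG :=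
  have : Module.Finite Aᵐᵒᵖ M.carrier := hM
  have : Module.Finite Aᵐᵒᵖ N.carrier := hN
  inferInstanceAs (Module.Finite Aᵐᵒᵖ (M.carrier × N.carrier))

theorem IsFG.shift {M : GrModule 𝒜} (hM : M.IsFG) (δ : Γ) : (M.shift δ).IsFG := hM

theorem isGradedProjective_zero : (zero 𝒜).IsGradedProjective := by
  intro M N g j _ _ _
  refine ⟨0, fun i m _ => (M.deg i).zero_mem, ?_⟩
  ext p
  have : p = 0 := Subsingleton.elim (α := PUnit) _ _
  simp [this]

theorem IsGradedProjective.prod {P Q : GrModule 𝒜} (hP : P.IsGradedProjective)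
    (hQ : Q.IsGradedProjective) : (P.prod Q).IsGradedProjective := by
  intro M N g j hg hs hj
  obtain ⟨h₁, hh₁, e₁⟩ := hP M N g (j ∘ₗ LinearMap.inl Aᵐᵒᵖ P.carrier Q.carrier) hg hs
    fun i m hm => hj i (m, 0) ⟨hm, (Q.deg i).zero_mem⟩
  obtain ⟨h₂, hh₂, e₂⟩ := hQ M N g (j ∘ₗ LinearMap.inr Aᵐᵒᵖ P.carrier Q.carrier) hg hs
    fun i m hm => hj i (0, m) ⟨(P.deg i).zero_mem, hm⟩
  refine ⟨LinearMap.coprod h₁ h₂, fun i m hm => ?_, ?_⟩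
  · exact (M.deg i).add_mem (hh₁ i _ hm.1) (hh₂ i _ hm.2)
  · exact LinearMap.ext fun m => by
      have h1 := LinearMap.congr_fun e₁ m.1
      have h2 := LinearMap.congr_fun e₂ m.2
      change g (h₁ m.1 + h₂ m.2) = j m
      rw [map_add]
      refine (congrArg₂ (· + ·) h1 h2).trans ?_
      refine (map_add j (m.1, 0) (0, m.2)).symm.trans (congrArg j ?_)
      exact Prod.ext (add_zero m.1) (zero_add m.2)

theorem IsGradedHom.shift {M N : GrModule 𝒜} {f : M.carrier →ₗ[Aᵐᵒᵖ] N.carrier}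
    (hf : IsGradedHom f) (δ : Γ) :
    IsGradedHom (M := M.shift δ) (N := N.shift δ) f := fun i m hm => hf (δ + i) m hm

theorem IsGradedProjective.shift {P : GrModule 𝒜} (hP : P.IsGradedProjective) (δ : Γ) :
    (P.shift δ).IsGradedProjective := by
  intro M N g j hg hs hj
  obtain ⟨h, hh, e⟩ := hP (M.shift (-δ)) (N.shift (-δ)) g j (hg.shift (-δ)) hs
    fun i m hm => hj (-δ + i) m (by
      change m ∈ P.deg (δ + (-δ + i))
      rwa [add_neg_cancel_left])
  refine ⟨h, fun i m hm => ?_, e⟩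
  have : h m ∈ M.deg (-δ + (δ + i)) := hh (δ + i) m hm
  rwa [neg_add_cancel_left] at this

end GrModule

/-- Objects of `Pgr-A`: graded finitely generated projective right modules. -/
def PgrModule (𝒜 : Γ → σ) [GradedRing 𝒜] : Type (max (u + 1) x) :=
  {P : GrModule 𝒜 // P.IsFG ∧ P.IsGradedProjective}

instance PgrModule.setoid (𝒜 : Γ → σ) [GradedRing 𝒜] : Setoid (PgrModule 𝒜) where
  r P Q := P.1.IsIso Q.1
  iseqv := ⟨fun P => .refl P.1, .symm, .trans⟩

/-- `𝒱^gr(A)`: graded isomorphism classes of graded finitely generated projective right modules. -/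
def Vgr (𝒜 : Γ → σ) [GradedRing 𝒜] : Type (max (u + 1) x) := Quotient (PgrModule.setoid 𝒜)

namespace Vgr

variable {𝒜 : Γ → σ} [GradedRing 𝒜]

/-- The class `[P]` in `𝒱^gr(A)`. -/
def mk (P : PgrModule 𝒜) : Vgr 𝒜 := Quotient.mk _ P

theorem sound {P Q : PgrModule 𝒜} (h : P.1.IsIso Q.1) : mk P = mk Q := Quotient.sound h

/-- `[P] + [Q] = [P ⊕ Q]`. -/
instance : Add (Vgr 𝒜) where
  add := Quotient.map₂ (fun P Q => ⟨P.1.prod Q.1, P.2.1.prod Q.2.1, P.2.2.prod Q.2.2⟩)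
    fun _ _ ⟨e, he⟩ _ _ ⟨f, hf⟩ =>
      ⟨e.prodCongr f, fun i _ hm => ⟨he i _ hm.1, hf i _ hm.2⟩⟩

instance : Zero (Vgr 𝒜) where
  zero := mk ⟨GrModule.zero 𝒜, GrModule.isFG_zero, GrModule.isGradedProjective_zero⟩

instance : AddCommMonoid (Vgr 𝒜) where
  add_assoc := by
    rintro ⟨P⟩ ⟨Q⟩ ⟨R⟩
    exact sound ⟨LinearEquiv.prodAssoc Aᵐᵒᵖ P.1.carrier Q.1.carrier R.1.carrier,
      fun i m hm => ⟨hm.1.1, hm.1.2, hm.2⟩⟩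
  zero_add := by
    rintro ⟨P⟩
    exact sound ⟨LinearEquiv.uniqueProd (R := Aᵐᵒᵖ) (M := P.1.carrier) (M₂ := PUnit.{u + 1}),
      fun i m hm => hm.2⟩
  add_zero := by
    rintro ⟨P⟩
    exact sound ⟨LinearEquiv.prodUnique (R := Aᵐᵒᵖ) (M := P.1.carrier) (M₂ := PUnit.{u + 1}),
      fun i m hm => hm.1⟩
  add_comm := by
    rintro ⟨P⟩ ⟨Q⟩
    exact sound ⟨LinearEquiv.prodComm Aᵐᵒᵖ P.1.carrier Q.1.carrier, fun i m hm => ⟨hm.2, hm.1⟩⟩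
  nsmul := nsmulRec

theorem mk_add_mk (P Q : PgrModule 𝒜) :
    mk P + mk Q = mk ⟨P.1.prod Q.1, P.2.1.prod Q.2.1, P.2.2.prod Q.2.2⟩ := rfl

/-- The action of `δ : Γ` on `𝒱^gr(A)`, `[P] ↦ [P(δ)]`. -/
def shift (δ : Γ) : Vgr 𝒜 →+ Vgr 𝒜 where
  toFun := Quotient.map (fun P => ⟨P.1.shift δ, P.2.1.shift δ, P.2.2.shift δ⟩)
    fun _ _ ⟨e, he⟩ => ⟨e, GrModule.IsGradedHom.shift he δ⟩
  map_zero' := sound ⟨LinearEquiv.refl _ _, fun _ _ h => h⟩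
  map_add' := by
    rintro ⟨P⟩ ⟨Q⟩
    exact sound ⟨LinearEquiv.refl _ _, fun _ _ h => h⟩

theorem shift_mk (δ : Γ) (P : PgrModule 𝒜) :
    shift δ (mk P) = mk ⟨P.1.shift δ, P.2.1.shift δ, P.2.2.shift δ⟩ := rfl

theorem shift_zero : shift (0 : Γ) = AddMonoidHom.id (Vgr 𝒜) := by
  ext ⟨P⟩
  refine sound ⟨LinearEquiv.refl _ _, fun i m hm => ?_⟩
  have hm' : m ∈ P.1.deg (0 + i) := hm
  rwa [zero_add] at hm'

theorem shift_add (δ ε : Γ) :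
    shift (δ + ε) = (shift δ).comp (shift ε : Vgr 𝒜 →+ Vgr 𝒜) := by
  ext ⟨P⟩
  refine sound ⟨LinearEquiv.refl _ _, fun i m hm => ?_⟩
  change m ∈ P.1.deg (ε + (δ + i))
  have hm' : m ∈ P.1.deg (δ + ε + i) := hm
  rwa [add_comm δ ε, add_assoc] at hm'

end Vgr

/-- The graded Grothendieck group `K₀^gr(A)`: the group completion of `𝒱^gr(A)`. -/
abbrev K0gr (𝒜 : Γ → σ) [GradedRing 𝒜] : Type (max (u + 1) x) :=
  Algebra.GrothendieckAddGroup (Vgr 𝒜)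

namespace K0gr

variable {𝒜 : Γ → σ} [GradedRing 𝒜]

/-- The natural map `𝒱^gr(A) → K₀^gr(A)`. -/
noncomputable def of : Vgr 𝒜 →+ K0gr 𝒜 := Algebra.GrothendieckAddGroup.of

/-- The positive cone `K₀^gr(A)₊`: the image of `𝒱^gr(A)` in `K₀^gr(A)`. -/
def posCone (𝒜 : Γ → σ) [GradedRing 𝒜] : Set (K0gr 𝒜) := Set.range (of (𝒜 := 𝒜))

theorem hom_ext {H : Type*} [AddCommGroup H] {f g : K0gr 𝒜 →+ H}
    (h : ∀ p, f (of p) = g (of p)) : f = g :=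
  Algebra.GrothendieckAddGroup.lift.symm.injective (AddMonoidHom.ext h)

/-- The action of `δ : Γ` on `K₀^gr(A)` induced by the shift `[P] ↦ [P(δ)]`. -/
noncomputable def shift (δ : Γ) : K0gr 𝒜 →+ K0gr 𝒜 :=
  Algebra.GrothendieckAddGroup.lift (of.comp (Vgr.shift δ))

theorem shift_of (δ : Γ) (p : Vgr 𝒜) : shift δ (of p) = of (Vgr.shift δ p) :=
  DFunLike.congr_fun
    (Algebra.GrothendieckAddGroup.lift.symm_apply_apply (of.comp (Vgr.shift δ))) p

/-- The action of the group `Γ` on `K₀^gr(A)`. -/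
noncomputable def shiftHom (𝒜 : Γ → σ) [GradedRing 𝒜] :
    Multiplicative Γ →* Module.End ℤ (K0gr 𝒜) where
  toFun δ := (shift δ.toAdd).toIntLinearMap
  map_one' := by
    have : shift (0 : Γ) = AddMonoidHom.id (K0gr 𝒜) := hom_ext fun p => by
      rw [shift_of, Vgr.shift_zero]; rfl
    ext α
    exact DFunLike.congr_fun this α
  map_mul' δ ε := by
    have : shift (δ.toAdd + ε.toAdd) = (shift δ.toAdd).comp (shift ε.toAdd : K0gr 𝒜 →+ _) :=
      hom_ext fun p => by
        rw [shift_of, Vgr.shift_add, AddMonoidHom.comp_apply]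
        exact ((congrArg (shift δ.toAdd) (shift_of _ p)).trans (shift_of _ _)).symm
    ext α
    exact DFunLike.congr_fun this α

/-- The `ℤ[Γ]`-module structure of `K₀^gr(A)`, in which `γ ∈ Γ` acts by `[P] ↦ [P(γ)]`. For `Γ = ℤ`
this is a `ℤ[x, x⁻¹]`-module structure. -/
noncomputable instance : Module (AddMonoidAlgebra ℤ Γ) (K0gr 𝒜) :=
  Module.compHom (K0gr 𝒜)
    (AddMonoidAlgebra.lift ℤ (Module.End ℤ (K0gr 𝒜)) Γ (shiftHom 𝒜)).toRingHom

theorem single_smul_of_mk (γ : Γ) (P : PgrModule 𝒜) :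
    (AddMonoidAlgebra.single γ 1 : AddMonoidAlgebra ℤ Γ) • of (Vgr.mk P) =
      of (Vgr.mk ⟨P.1.shift γ, P.2.1.shift γ, P.2.2.shift γ⟩) := by
  change (AddMonoidAlgebra.lift ℤ (Module.End ℤ (K0gr 𝒜)) Γ (shiftHom 𝒜)
    (AddMonoidAlgebra.single γ 1)) (of (Vgr.mk P)) = _
  rw [AddMonoidAlgebra.lift_single, one_smul]
  exact shift_of γ (Vgr.mk P)

end K0gr

end GradedModules

/-! ### Directed graphs and Leavitt path algebras -/

/-- A directed graph `(E⁰, E¹, r, s)` with vertex set `V = E⁰`, edge set `E = E¹`, and range and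
source maps `r`, `s`. -/
structure DirectedGraph (V : Type u) (E : Type v) where
  r : E → V
  s : E → V

namespace DirectedGraph

variable {V : Type u} {E : Type v} [Fintype V] [Fintype E] [DecidableEq V]

/-- `(n_{v,w})`, where `n_{v,w}` is the number of edges with source `v` and range `w`. -/
def adjMatrix (G : DirectedGraph V E) : Matrix V V ℤ :=
  Matrix.of fun v w => ((Finset.univ.filter fun e => G.s e = v ∧ G.r e = w).card : ℤ)

/-- A graph has no sinks if every vertex emits an edge. -/
def NoSinks (G : DirectedGraph V E) : Prop := ∀ v, ∃ e, G.s e = v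

end DirectedGraph

/-- The generators `v`, `α`, `α*` of the Leavitt path algebra. -/
inductive LPAGen (V : Type u) (E : Type v) : Type (max u v)
  | vertex (v : V)
  | edge (e : E)
  | ghost (e : E)

namespace LPAGen

variable {V : Type u} {E : Type v}

/-- `deg v = 0`, `deg α = 1`, `deg α* = -1`. -/
def degree : LPAGen V E → ℤ
  | vertex _ => 0
  | edge _ => 1
  | ghost _ => -1

end LPAGen

section LPA

variable {V : Type u} {E : Type v} [Fintype V] [Fintype E] [DecidableEq V]
variable (K : Type w) [Field K] (G : DirectedGraph V E)

open LPAGen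

/-- The defining relations of the Leavitt path algebra of a finite graph. The last relation identifies
the unit of the (unital) free algebra with `∑ v`, which is the identity of the algebra presented
by the other relations. -/
inductive LPARel : FreeAlgebra K (LPAGen V E) → FreeAlgebra K (LPAGen V E) → Prop
  | vertex_mul_self (v : V) : LPARel
      (FreeAlgebra.ι K (vertex v) * FreeAlgebra.ι K (vertex v)) (FreeAlgebra.ι K (vertex v))
  | vertex_mul_of_ne (v w : V) (h : v ≠ w) : LPARel
      (FreeAlgebra.ι K (vertex v) * FreeAlgebra.ι K (vertex w)) 0
  | source_mul_edge (e : E) : LPARel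
      (FreeAlgebra.ι K (vertex (G.s e)) * FreeAlgebra.ι K (edge e)) (FreeAlgebra.ι K (edge e))
  | edge_mul_range (e : E) : LPARel
      (FreeAlgebra.ι K (edge e) * FreeAlgebra.ι K (vertex (G.r e))) (FreeAlgebra.ι K (edge e))
  | range_mul_ghost (e : E) : LPARel
      (FreeAlgebra.ι K (vertex (G.r e)) * FreeAlgebra.ι K (ghost e)) (FreeAlgebra.ι K (ghost e))
  | ghost_mul_source (e : E) : LPARel
      (FreeAlgebra.ι K (ghost e) * FreeAlgebra.ι K (vertex (G.s e))) (FreeAlgebra.ι K (ghost e))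
  | ghost_mul_edge (e : E) : LPARel
      (FreeAlgebra.ι K (ghost e) * FreeAlgebra.ι K (edge e)) (FreeAlgebra.ι K (vertex (G.r e)))
  | ghost_mul_edge_of_ne (e f : E) (h : e ≠ f) : LPARel
      (FreeAlgebra.ι K (ghost e) * FreeAlgebra.ι K (edge f)) 0
  | sum_edge_mul_ghost (v : V) (h : ∃ e, G.s e = v) : LPARel
      (∑ e ∈ Finset.univ.filter (fun e => G.s e = v),
        FreeAlgebra.ι K (edge e) * FreeAlgebra.ι K (ghost e)) (FreeAlgebra.ι K (vertex v))
  | sum_vertex : LPARel (∑ v : V, FreeAlgebra.ι K (vertex v)) 1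

/-- The Leavitt path algebra `L_K(E)` of a finite graph. -/
abbrev LPA : Type (max u v w) := RingQuot (LPARel K G)

namespace LPA

/-- The image of a generator in `L_K(E)`. -/
noncomputable def gen (g : LPAGen V E) : LPA K G :=
  RingQuot.mkAlgHom K (LPARel K G) (FreeAlgebra.ι K g)

/-- The degree `k` component of `L_K(E)`: the span of all words in the generators of total
degree `k`. -/
noncomputable def grading (k : ℤ) : Submodule K (LPA K G) :=
  Submodule.span K
    {a | ∃ l : List (LPAGen V E), (l.map degree).sum = k ∧ (l.map (gen K G)).prod = a}

instance : SetLike.GradedMonoid (grading K G) where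
  one_mem := Submodule.subset_span ⟨[], by simp, by simp⟩
  mul_mem i j a b ha hb := by
    have h := Submodule.mul_mem_mul ha hb
    rw [grading, grading, Submodule.span_mul_span] at h
    refine Submodule.span_mono ?_ h
    rintro _ ⟨_, ⟨l, hl, rfl⟩, _, ⟨l', hl', rfl⟩, rfl⟩
    exact ⟨l ++ l', by simp [hl, hl'], by simp⟩

theorem gen_mem (g : LPAGen V E) : gen K G g ∈ grading K G g.degree :=
  Submodule.subset_span ⟨[g], by simp, by simp⟩

/-- A generator as a homogeneous element of `⨁ L_k`. -/
noncomputable def genDecomp (g : LPAGen V E) : ⨁ k, grading K G k :=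
  DirectSum.of (fun k => grading K G k) g.degree ⟨gen K G g, gen_mem K G g⟩

theorem gen_rel {a b : FreeAlgebra K (LPAGen V E)} (h : LPARel K G a b) :
    FreeAlgebra.lift K (gen K G) a = FreeAlgebra.lift K (gen K G) b := by
  have : FreeAlgebra.lift K (gen K G) = RingQuot.mkAlgHom K (LPARel K G) := by
    ext g; simp [gen]
  rw [this]
  exact RingQuot.mkAlgHom_rel K h

theorem of_congr {i j : ℤ} (hij : i = j) {a b : LPA K G} (hab : a = b)
    (ha : a ∈ grading K G i) (hb : b ∈ grading K G j) :
    DirectSum.of (fun k => grading K G k) i ⟨a, ha⟩ =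
      DirectSum.of (fun k => grading K G k) j ⟨b, hb⟩ := by
  subst hij hab; rfl

theorem genDecomp_mul (g h : LPAGen V E) :
    genDecomp K G g * genDecomp K G h =
      DirectSum.of (fun k => grading K G k) (g.degree + h.degree)
        ⟨gen K G g * gen K G h, SetLike.mul_mem_graded (gen_mem K G g) (gen_mem K G h)⟩ :=
  DirectSum.of_mul_of _ _

theorem genDecomp_mul_eq (g h k : LPAGen V E) (hd : g.degree + h.degree = k.degree)
    (hr : gen K G g * gen K G h = gen K G k) :
    genDecomp K G g * genDecomp K G h = genDecomp K G k := by
  rw [genDecomp_mul]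
  exact of_congr K G hd hr _ _

theorem genDecomp_mul_eq_zero (g h : LPAGen V E) (hr : gen K G g * gen K G h = 0) :
    genDecomp K G g * genDecomp K G h = 0 := by
  rw [genDecomp_mul]
  have : (⟨gen K G g * gen K G h, SetLike.mul_mem_graded (gen_mem K G g) (gen_mem K G h)⟩ :
    grading K G (g.degree + h.degree)) = 0 := Subtype.ext hr
  rw [this, map_zero]

theorem edge_mul_ghost_mem (e : E) :
    gen K G (edge e) * gen K G (ghost e) ∈ grading K G 0 := by
  have h := SetLike.mul_mem_graded (gen_mem K G (edge e)) (gen_mem K G (ghost e))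
  have h0 : (edge e : LPAGen V E).degree + (ghost e : LPAGen V E).degree = 0 := by simp [degree]
  rwa [h0] at h

theorem genDecomp_edge_mul_ghost (e : E) :
    genDecomp K G (edge e) * genDecomp K G (ghost e) =
      DirectSum.of (fun k => grading K G k) 0
        ⟨gen K G (edge e) * gen K G (ghost e), edge_mul_ghost_mem K G e⟩ := by
  rw [genDecomp_mul]
  exact of_congr K G (by simp [degree]) rfl _ _

theorem genDecomp_rel {a b : FreeAlgebra K (LPAGen V E)} (h : LPARel K G a b) :
    FreeAlgebra.lift K (genDecomp K G) a = FreeAlgebra.lift K (genDecomp K G) b := by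
  have hr := gen_rel K G h
  cases h with
  | sum_edge_mul_ghost v h =>
    simp only [map_sum, map_mul, FreeAlgebra.lift_ι_apply] at hr ⊢
    simp only [genDecomp_edge_mul_ghost]
    rw [← map_sum]
    refine congrArg (DirectSum.of (fun k => grading K G k) 0) (Subtype.ext ?_)
    simpa using hr
  | sum_vertex =>
    simp only [map_sum, map_one, FreeAlgebra.lift_ι_apply] at hr ⊢
    have h0 : ∀ v : V, genDecomp K G (vertex v) =
        DirectSum.of (fun k => grading K G k) 0 ⟨gen K G (vertex v), gen_mem K G (vertex v)⟩ :=
      fun v => rfl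
    simp only [h0]
    rw [← map_sum, DirectSum.one_def]
    refine congrArg (DirectSum.of (fun k => grading K G k) 0) (Subtype.ext ?_)
    simpa using hr
  | vertex_mul_of_ne v w h =>
    simp only [map_mul, map_zero, FreeAlgebra.lift_ι_apply] at hr ⊢
    exact genDecomp_mul_eq_zero K G _ _ hr
  | ghost_mul_edge_of_ne e f h =>
    simp only [map_mul, map_zero, FreeAlgebra.lift_ι_apply] at hr ⊢
    exact genDecomp_mul_eq_zero K G _ _ hr
  | _ =>
    simp only [map_mul, FreeAlgebra.lift_ι_apply] at hr ⊢
    exact genDecomp_mul_eq K G _ _ _ (by simp [degree]) hr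

/-- The decomposition map `L_K(E) → ⨁ L_k`. -/
noncomputable def decompHom : LPA K G →ₐ[K] ⨁ k, grading K G k :=
  RingQuot.liftAlgHom K ⟨FreeAlgebra.lift K (genDecomp K G), fun _ _ h => genDecomp_rel K G h⟩

theorem decompHom_gen (g : LPAGen V E) : decompHom K G (gen K G g) = genDecomp K G g := by
  simp [decompHom, gen]

theorem decompHom_prod (l : List (LPAGen V E)) :
    decompHom K G (l.map (gen K G)).prod =
      DirectSum.of (fun k => grading K G k) (l.map degree).sum
        ⟨(l.map (gen K G)).prod, Submodule.subset_span ⟨l, rfl, rfl⟩⟩ := by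
  induction l with
  | nil => simp only [List.map_nil, List.prod_nil, map_one]; rfl
  | cons g l ih =>
    simp only [List.map_cons, List.prod_cons, map_mul]
    rw [ih, decompHom_gen, genDecomp, DirectSum.of_mul_of]
    exact of_congr K G (by simp) rfl _ _

/-- The standard `ℤ`-grading of the Leavitt path algebra. -/
noncomputable instance : GradedAlgebra (grading K G) :=
  GradedAlgebra.ofAlgHom (grading K G) (decompHom K G)
    (by
      refine RingQuot.ringQuot_ext' _ _ _ (FreeAlgebra.hom_ext (funext fun g => ?_))
      change DirectSum.coeAlgHom (grading K G) (decompHom K G (gen K G g)) = gen K G g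
      rw [decompHom_gen, genDecomp, DirectSum.coeAlgHom_of])
    (by
      rintro i ⟨a, ha⟩
      change decompHom K G a = _
      induction ha using Submodule.span_induction with
      | mem a h =>
        obtain ⟨l, rfl, rfl⟩ := h
        exact decompHom_prod K G l
      | zero =>
        rw [map_zero]
        exact (map_zero (DirectSum.of (fun k => grading K G k) i)).symm
      | add a b ha hb iha ihb =>
        rw [map_add, iha, ihb, ← map_add]
        rfl
      | smul c a ha iha =>
        rw [map_smul, iha]
        exact (map_smul (DirectSum.lof K ℤ (fun k => grading K G k) i) c ⟨a, ha⟩).symm)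

end LPA

end LPA

/-! ### Krieger's dimension group -/

section Krieger

variable {n : Type u} [Fintype n] [DecidableEq n]

/-- The transition maps `A ^ (j - i) : ℤⁿ → ℤⁿ` of the stationary system given by `A`. -/
def stationaryMap (A : Matrix n n ℤ) (i j : ℕ) (_ : i ≤ j) : (n → ℤ) →+ (n → ℤ) :=
  (A ^ (j - i)).mulVecLin.toAddMonoidHom

/-- `Δ_A`, the direct limit of `ℤⁿ → ℤⁿ → ℤⁿ → ⋯`, all maps being multiplication by `A` from
the left. -/
abbrev KriegerGroup (A : Matrix n n ℤ) : Type u :=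
  AddCommGroup.DirectLimit (fun _ : ℕ => n → ℤ) (stationaryMap A)

namespace KriegerGroup

variable (A : Matrix n n ℤ)

/-- The class `[a, k] ∈ Δ_A` of a vector `a` in the `k`-th copy of `ℤⁿ`. -/
noncomputable def mk (k : ℕ) : (n → ℤ) →+ KriegerGroup A :=
  AddCommGroup.DirectLimit.of (fun _ : ℕ => n → ℤ) (stationaryMap A) k

/-- The positive cone `Δ_A⁺`: the classes `[a, k]` with `a` nonnegative. -/
def posCone : Set (KriegerGroup A) := {z | ∃ (k : ℕ) (a : n → ℤ), 0 ≤ a ∧ z = mk A k a}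

/-- The endomorphism `[a, k] ↦ [A a, k]` of `Δ_A` induced by `A`. -/
noncomputable def deltaHom : KriegerGroup A →+ KriegerGroup A :=
  AddCommGroup.DirectLimit.map (fun _ => A.mulVecLin.toAddMonoidHom) fun i j h => by
    refine AddMonoidHom.ext fun a => ?_
    change A *ᵥ ((A ^ (j - i)) *ᵥ a) = (A ^ (j - i)) *ᵥ (A *ᵥ a)
    rw [Matrix.mulVec_mulVec, Matrix.mulVec_mulVec, (Commute.self_pow A _).eq]

theorem deltaHom_mk (k : ℕ) (a : n → ℤ) : deltaHom A (mk A k a) = mk A k (A *ᵥ a) :=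
  AddCommGroup.DirectLimit.map_apply_of _ _ _

theorem mk_succ_mulVec (k : ℕ) (a : n → ℤ) : mk A (k + 1) (A *ᵥ a) = mk A k a := by
  have h := AddCommGroup.DirectLimit.of_f (G := fun _ : ℕ => n → ℤ) (f := stationaryMap A)
    (Nat.le_succ k) a
  have h' : stationaryMap A k (k + 1) (Nat.le_succ k) a = A *ᵥ a := by
    change (A ^ (k + 1 - k)) *ᵥ a = _
    simp
  rw [← h']
  exact h

/-- The inverse `[a, k] ↦ [a, k + 1]` of `deltaHom`. -/
noncomputable def deltaInv : KriegerGroup A →+ KriegerGroup A :=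
  AddCommGroup.DirectLimit.lift _ _ _ (fun k => mk A (k + 1)) fun i j h a => by
    have h1 := AddCommGroup.DirectLimit.of_f (G := fun _ : ℕ => n → ℤ) (f := stationaryMap A)
      (Nat.succ_le_succ h) a
    have h2 : stationaryMap A (i + 1) (j + 1) (Nat.succ_le_succ h) a = stationaryMap A i j h a := by
      change (A ^ (j + 1 - (i + 1))) *ᵥ a = (A ^ (j - i)) *ᵥ a
      rw [Nat.add_sub_add_right]
    rw [← h2]
    exact h1

theorem deltaInv_mk (k : ℕ) (a : n → ℤ) : deltaInv A (mk A k a) = mk A (k + 1) a :=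
  AddCommGroup.DirectLimit.lift_of _ _ _ _ _

/-- The automorphism `δ_A` of `Δ_A` induced by `A`: `δ_A [a, k] = [A a, k]`. -/
noncomputable def delta : KriegerGroup A ≃+ KriegerGroup A :=
  AddMonoidHom.toAddEquiv (deltaHom A) (deltaInv A)
    (AddCommGroup.DirectLimit.hom_ext _ fun k => AddMonoidHom.ext fun a => by
      change deltaInv A (deltaHom A (mk A k a)) = mk A k a
      rw [deltaHom_mk, deltaInv_mk, mk_succ_mulVec])
    (AddCommGroup.DirectLimit.hom_ext _ fun k => AddMonoidHom.ext fun a => by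
      change deltaHom A (deltaInv A (mk A k a)) = mk A k a
      rw [deltaInv_mk, deltaHom_mk, mk_succ_mulVec])

end KriegerGroup

end Krieger

/-! Write `L` for the Leavitt path algebra. A frame of degree `k` identifies a graded module `P`
with a finite direct sum of modules `(v_j L)(-k)`. If the vertex `u` occurs `a u` times among the
`v_j`, the class of `P` in the dimension group is taken to be `[a, k]`. Since `v L` is the direct
sum of the `e L` over the edges `e` with source `v`, and `e L` is `r(e) L` shifted by `-1`, a frame
of degree `k` with count `a` refines to one of degree `k + 1` with count `A^t a`
(`colorCount_refine`). This is the identification `[a, k] = [A^t a, k + 1]` made in the direct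
limit.

The crux is that degree-zero elements become scalar after compression: for `x` in `L_0` and all
sufficiently large `n`, every `p* x q` with `p`, `q` of length `n` lies in the span of the vertices
(`exists_isDiagAt`). Refining `n` times replaces the entries `x` of a transition matrix between
frames by such compressions, so questions over `L_0` become linear algebra over `K`, one vertex at a
time. Two consequences carry the proof.

Uniqueness: the transition matrices between two frames of the same degree become mutually inverse
scalar blocks, hence square, and the counts agree after applying a power of `A^t`
(`exists_pow_mulVec_colorCount_eq`). Comparing scalars requires the vertices to be nonzero, which a
representation on functions shows (`vx_ne_zero`).

Existence: a graded finitely generated projective module is generated by one component `P_k`, so it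
is a retract of a sum of copies of `L(-k)` and has a pre-frame. The transition matrix of the
pre-frame with itself is idempotent; after refinement its blocks are idempotent matrices over `K`,
and factoring them through their ranks gives a frame (`exists_hasFrame`).

Equal classes give equal counts after refinement, hence isomorphic modules, so the monoid of graded
classes embeds in the dimension group and its group completion does too. The image of the monoid is
the positive cone, because `(v L)(-k)` realises `[e_v, k]`, and the cone generates the group. The
shift lowers the degree of a frame by one, which is `δ`. -/

namespace LPA

open LPAGen

variable {V : Type u} {E : Type v} [Fintype V] [Fintype E] [DecidableEq V]
variable (K : Type w) [Field K] (G : DirectedGraph V E)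

/-! ### The generators of the Leavitt path algebra -/

/-- The idempotent of a vertex. -/
noncomputable def vx (v : V) : LPA K G := gen K G (vertex v)

/-- The element of an edge. -/
noncomputable def ed (e : E) : LPA K G := gen K G (edge e)

/-- The element of a ghost edge. -/
noncomputable def gh (e : E) : LPA K G := gen K G (ghost e)

variable {K G} in
theorem mkAlgHom_eq {a b : FreeAlgebra K (LPAGen V E)} (h : LPARel K G a b) :
    RingQuot.mkAlgHom K (LPARel K G) a = RingQuot.mkAlgHom K (LPARel K G) b :=
  RingQuot.mkAlgHom_rel K h

theorem vx_mul_self (v : V) : vx K G v * vx K G v = vx K G v := by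
  simpa only [map_mul, vx, ed, gh, gen] using mkAlgHom_eq (.vertex_mul_self (K := K) (G := G) v)

theorem vx_mul_of_ne {v w : V} (h : v ≠ w) : vx K G v * vx K G w = 0 := by
  simpa only [map_mul, map_zero, vx, ed, gh, gen] using mkAlgHom_eq (.vertex_mul_of_ne (K := K) (G := G) v w h)

theorem vx_mul_vx (v w : V) : vx K G v * vx K G w = if v = w then vx K G v else 0 := by
  split_ifs with h
  · rw [← h, vx_mul_self]
  · exact vx_mul_of_ne K G h

theorem vx_mul_ed (e : E) : vx K G (G.s e) * ed K G e = ed K G e := by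
  simpa only [map_mul, vx, ed, gh, gen] using mkAlgHom_eq (.source_mul_edge (K := K) (G := G) e)

theorem ed_mul_vx (e : E) : ed K G e * vx K G (G.r e) = ed K G e := by
  simpa only [map_mul, vx, ed, gh, gen] using mkAlgHom_eq (.edge_mul_range (K := K) (G := G) e)

theorem vx_mul_gh (e : E) : vx K G (G.r e) * gh K G e = gh K G e := by
  simpa only [map_mul, vx, ed, gh, gen] using mkAlgHom_eq (.range_mul_ghost (K := K) (G := G) e)

theorem gh_mul_vx (e : E) : gh K G e * vx K G (G.s e) = gh K G e := by
  simpa only [map_mul, vx, ed, gh, gen] using mkAlgHom_eq (.ghost_mul_source (K := K) (G := G) e)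

theorem gh_mul_ed_self (e : E) : gh K G e * ed K G e = vx K G (G.r e) := by
  simpa only [map_mul, vx, ed, gh, gen] using mkAlgHom_eq (.ghost_mul_edge (K := K) (G := G) e)

theorem gh_mul_ed_of_ne {e f : E} (h : e ≠ f) : gh K G e * ed K G f = 0 := by
  simpa only [map_mul, map_zero, vx, ed, gh, gen] using mkAlgHom_eq (.ghost_mul_edge_of_ne (K := K) (G := G) e f h)

theorem sum_ed_mul_gh (hG : G.NoSinks) (v : V) :
    ∑ e ∈ Finset.univ.filter (fun e => G.s e = v), ed K G e * gh K G e = vx K G v := by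
  simpa only [map_mul, map_sum, vx, ed, gh, gen] using
    mkAlgHom_eq (.sum_edge_mul_ghost (K := K) (G := G) v (hG v))

theorem sum_vx : ∑ v : V, vx K G v = 1 := by
  simpa only [map_one, map_sum, vx, gen] using mkAlgHom_eq (.sum_vertex (K := K) (G := G))

theorem vx_mem (v : V) : vx K G v ∈ grading K G 0 := gen_mem K G (vertex v)

theorem ed_mem (e : E) : ed K G e ∈ grading K G 1 := gen_mem K G (edge e)

theorem gh_mem (e : E) : gh K G e ∈ grading K G (-1) := gen_mem K G (ghost e)

theorem mul_mem {i j k : ℤ} {a b : LPA K G} (ha : a ∈ grading K G i) (hb : b ∈ grading K G j)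
    (h : i + j = k) : a * b ∈ grading K G k :=
  h ▸ SetLike.mul_mem_graded ha hb

/-- Multiplication by `a` from the left, as an endomorphism of the right module `L_K(E)`. -/
noncomputable def leftMul (a : LPA K G) : LPA K G →ₗ[(LPA K G)ᵐᵒᵖ] LPA K G where
  toFun x := a * x
  map_add' := mul_add a
  map_smul' c x := by
    change a * (x * c.unop) = a * x * c.unop
    rw [mul_assoc]

variable {K G} in
@[simp] theorem leftMul_apply (a x : LPA K G) : leftMul K G a x = a * x := rfl

/-! ### Vertices are nonzero -/

section Representation

variable {G}

/-- Without sinks, the edges leaving `v`, each taken countably often, form a countably infinite set,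
in bijection with `ℕ`. These bijections are glued over the vertices. -/
theorem exists_equiv_edge (hG : G.NoSinks) :
    ∃ θ : V × ℕ ≃ E × ℕ, ∀ x, G.s (θ x).1 = x.1 := by
  have h (v : V) : Nonempty (ℕ ≃ {e // G.s e = v} × ℕ) := by
    obtain ⟨e, he⟩ := hG v
    have : Nonempty {e // G.s e = v} := ⟨⟨e, he⟩⟩
    have : Encodable {e // G.s e = v} := Fintype.toEncodable _
    have : Infinite ({e // G.s e = v} × ℕ) := inferInstance
    have := Denumerable.ofEncodableOfInfinite ({e // G.s e = v} × ℕ)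
    exact ⟨(Denumerable.eqv _).symm⟩
  let t v := Classical.choice (h v)
  let θ : V × ℕ ≃ E × ℕ :=
    { toFun := fun x => ((t x.1 x.2).1.1, (t x.1 x.2).2)
      invFun := fun y => (G.s y.1, (t (G.s y.1)).symm (⟨y.1, rfl⟩, y.2))
      left_inv := by
        rintro ⟨v, n⟩
        -- The bijection `t` depends on the vertex, and the source of the edge equals `v` only
        -- propositionally; hence the generalisation to `w`.
        have key : ∀ (w : V) (z : {e // G.s e = v} × ℕ) (hw : G.s z.1.1 = w),
            ((w, (t w).symm (⟨z.1.1, hw⟩, z.2)) : V × ℕ) = (v, (t v).symm z) := by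
          rintro w ⟨⟨e, rfl⟩, m⟩ rfl
          rfl
        have := key _ (t v n) rfl
        rw [Equiv.symm_apply_apply] at this
        exact this
      right_inv := by
        rintro ⟨e, n⟩
        simp }
  exact ⟨θ, fun x => (t x.1 x.2).1.2⟩

open Classical in
/-- The action of the generators on functions on `V × ℕ` determined by a bijection
`V × ℕ ≃ E × ℕ` over the source map. -/
noncomputable def genAction (θ : V × ℕ ≃ E × ℕ) : LPAGen V E → Module.End K (V × ℕ → K)
  | vertex v =>
    { toFun := fun f x => if x.1 = v then f x else 0
      map_add' := fun f g => by ext x; simp only [Pi.add_apply]; split_ifs <;> simp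
      map_smul' := fun c f => by ext x; simp }
  | edge e =>
    { toFun := fun f x => if (θ x).1 = e then f (G.r e, (θ x).2) else 0
      map_add' := fun f g => by ext x; simp only [Pi.add_apply]; split_ifs <;> simp
      map_smul' := fun c f => by ext x; simp }
  | ghost e =>
    { toFun := fun f x => if x.1 = G.r e then f (θ.symm (e, x.2)) else 0
      map_add' := fun f g => by ext x; simp only [Pi.add_apply]; split_ifs <;> simp
      map_smul' := fun c f => by ext x; simp }

theorem genAction_vertex (θ : V × ℕ ≃ E × ℕ) (v : V) (f : V × ℕ → K) (x : V × ℕ) :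
    genAction (G := G) K θ (vertex v) f x = if x.1 = v then f x else 0 := by
  simp [genAction]

open Classical in
theorem genAction_edge (θ : V × ℕ ≃ E × ℕ) (e : E) (f : V × ℕ → K) (x : V × ℕ) :
    genAction (G := G) K θ (edge e) f x = if (θ x).1 = e then f (G.r e, (θ x).2) else 0 := by
  simp [genAction]

theorem genAction_ghost (θ : V × ℕ ≃ E × ℕ) (e : E) (f : V × ℕ → K) (x : V × ℕ) :
    genAction (G := G) K θ (ghost e) f x =
      if x.1 = G.r e then f (θ.symm (e, x.2)) else 0 := by
  simp [genAction]

/-- The operators of `e` and `e*` carry functions supported on `{r(e)} × ℕ` and on `θ⁻¹({e} × ℕ)`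
into each other. By `hθ`, the latter sets with `s(e) = v` partition `{v} × ℕ`, which gives the
relation `∑ e e* = v`. -/
theorem genAction_rel {θ : V × ℕ ≃ E × ℕ} (hθ : ∀ x, G.s (θ x).1 = x.1)
    {a b : FreeAlgebra K (LPAGen V E)} (h : LPARel K G a b) :
    FreeAlgebra.lift K (genAction (G := G) K θ) a =
      FreeAlgebra.lift K (genAction (G := G) K θ) b := by
  classical
  have hs (e : E) (n : ℕ) : (θ.symm (e, n)).1 = G.s e := by
    rw [← hθ, Equiv.apply_symm_apply]
  refine LinearMap.ext fun f => funext fun x => ?_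
  cases h with
  | vertex_mul_self v =>
    simp only [map_mul, FreeAlgebra.lift_ι_apply, Module.End.mul_apply, genAction_vertex]
    split_ifs <;> rfl
  | vertex_mul_of_ne v w h =>
    simp only [map_mul, map_zero, FreeAlgebra.lift_ι_apply, Module.End.mul_apply,
      genAction_vertex]
    split_ifs with h1 h2
    · exact absurd (h1.symm.trans h2) h
    · rfl
    · rfl
  | source_mul_edge e =>
    simp only [map_mul, FreeAlgebra.lift_ι_apply, Module.End.mul_apply, genAction_vertex,
      genAction_edge]
    split_ifs with h1 h2 h2
    · rfl
    · rfl
    · exact absurd (by rw [← hθ, h2]) h1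
    · rfl
  | edge_mul_range e =>
    simp only [map_mul, FreeAlgebra.lift_ι_apply, Module.End.mul_apply, genAction_vertex,
      genAction_edge, if_true]
  | range_mul_ghost e =>
    simp only [map_mul, FreeAlgebra.lift_ι_apply, Module.End.mul_apply, genAction_vertex,
      genAction_ghost]
    split_ifs <;> rfl
  | ghost_mul_source e =>
    simp only [map_mul, FreeAlgebra.lift_ι_apply, Module.End.mul_apply, genAction_vertex,
      genAction_ghost, hs, if_true]
  | ghost_mul_edge e =>
    simp only [map_mul, FreeAlgebra.lift_ι_apply, Module.End.mul_apply, genAction_vertex,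
      genAction_ghost, genAction_edge, Equiv.apply_symm_apply, if_true]
    split_ifs with h1
    · rw [← h1]
    · rfl
  | ghost_mul_edge_of_ne e f h =>
    simp only [map_mul, map_zero, FreeAlgebra.lift_ι_apply, Module.End.mul_apply,
      genAction_ghost, genAction_edge, Equiv.apply_symm_apply, h, if_false, ite_self]
    rfl
  | sum_edge_mul_ghost v h =>
    simp only [map_sum, map_mul, FreeAlgebra.lift_ι_apply, LinearMap.sum_apply,
      Finset.sum_apply, Module.End.mul_apply, genAction_vertex, genAction_ghost, genAction_edge,
      if_true]
    rw [Finset.sum_ite_eq]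
    simp [hθ]
  | sum_vertex =>
    simp only [map_sum, map_one, FreeAlgebra.lift_ι_apply, LinearMap.sum_apply,
      Finset.sum_apply, genAction_vertex]
    simp

/-- This is what allows scalar coefficients of a vertex to be compared later. -/
theorem vx_ne_zero (hG : G.NoSinks) (v : V) : vx K G v ≠ 0 := by
  obtain ⟨θ, hθ⟩ := exists_equiv_edge hG
  let ρ : LPA K G →ₐ[K] Module.End K (V × ℕ → K) :=
    RingQuot.liftAlgHom K ⟨FreeAlgebra.lift K (genAction K θ), fun _ _ h => genAction_rel K hθ h⟩
  intro h
  have h1 : ρ (vx K G v) = genAction (G := G) K θ (vertex v) := by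
    simp [ρ, vx, gen]
  rw [h, map_zero] at h1
  -- The operator of `v` sends the constant function `1` to a function with value `1` at `(v, 0)`.
  have h2 := congrFun (LinearMap.congr_fun h1 1) (v, 0)
  rw [genAction_vertex] at h2
  simp at h2

end Representation

/-! ### Compression of elements of degree zero to diagonal elements -/

/-- Elements all of whose corners `v x w` are `0` for `v ≠ w` and multiples of `v` for `v = w`,
that is, elements of the span of the vertices. -/
def IsDiag (x : LPA K G) : Prop :=
  ∀ v w, ∃ c : K, vx K G v * x * vx K G w = if v = w then c • vx K G v else 0

variable {K G}

theorem IsDiag.zero : IsDiag K G 0 := fun v w => ⟨0, by simp⟩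

theorem IsDiag.add {x y : LPA K G} (hx : IsDiag K G x) (hy : IsDiag K G y) :
    IsDiag K G (x + y) := by
  intro v w
  obtain ⟨c, hc⟩ := hx v w
  obtain ⟨d, hd⟩ := hy v w
  refine ⟨c + d, ?_⟩
  rw [mul_add, add_mul, hc, hd]
  split_ifs
  · rw [add_smul]
  · rw [add_zero]

theorem IsDiag.smul {x : LPA K G} (k : K) (hx : IsDiag K G x) : IsDiag K G (k • x) := by
  intro v w
  obtain ⟨c, hc⟩ := hx v w
  refine ⟨k * c, ?_⟩
  rw [mul_smul_comm, smul_mul_assoc, hc]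
  split_ifs
  · rw [mul_smul]
  · rw [smul_zero]

theorem isDiag_vx (u : V) : IsDiag K G (vx K G u) := by
  intro v w
  refine ⟨if v = u then 1 else 0, ?_⟩
  rw [vx_mul_vx]
  split_ifs with h1 h2 h2
  · rw [vx_mul_vx, if_pos h2, one_smul]
  · rw [vx_mul_vx, if_neg h2]
  · simp
  · simp

theorem isDiag_one : IsDiag K G 1 := by
  intro v w
  refine ⟨1, ?_⟩
  rw [mul_one, vx_mul_vx, one_smul]

variable (K G)

/-- The product of a list of edges. -/
noncomputable def edProd (p : List E) : LPA K G := (p.map (ed K G)).prod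

/-- The product of the ghost edges of the reverse of a list of edges. -/
noncomputable def ghProd : List E → LPA K G
  | [] => 1
  | e :: p => ghProd p * gh K G e

/-- `p* x q` is diagonal for all lists `p`, `q` of `n` edges. -/
def IsDiagAt (n : ℕ) (x : LPA K G) : Prop :=
  ∀ p q : List E, p.length = n → q.length = n → IsDiag K G (ghProd K G p * x * edProd K G q)

variable {K G}

/-- Edges cancel from the middle by `e* f = δ r(e)`. Equal lengths leave only `0`, a vertex, or the
empty product `1`; the lists need not be paths. -/
theorem isDiag_ghProd_mul_edProd (p q : List E) (h : p.length = q.length) :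
    IsDiag K G (ghProd K G p * edProd K G q) := by
  induction p generalizing q with
  | nil =>
    obtain rfl : q = [] := List.length_eq_zero_iff.1 h.symm
    simpa [ghProd, edProd] using isDiag_one
  | cons e p ih =>
    cases q with
    | nil => simp at h
    | cons f q =>
      have h' : p.length = q.length := by simpa using h
      have hf : edProd K G (f :: q) = ed K G f * edProd K G q := by simp [edProd]
      rw [hf, ghProd, mul_assoc, ← mul_assoc (gh K G e)]
      by_cases hef : e = f
      · rw [← hef, gh_mul_ed_self]
        cases q with
        | nil =>
          obtain rfl : p = [] := List.length_eq_zero_iff.1 h'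
          simpa [ghProd, edProd] using isDiag_vx _
        | cons f' q' =>
          by_cases hr : G.r e = G.s f'
          · have : vx K G (G.r e) * edProd K G (f' :: q') = edProd K G (f' :: q') := by
              simp only [edProd, List.map_cons, List.prod_cons, ← mul_assoc]
              rw [hr, vx_mul_ed]
            rw [this]
            exact ih _ h'
          · have : vx K G (G.r e) * edProd K G (f' :: q') = 0 := by
              simp only [edProd, List.map_cons, List.prod_cons, ← mul_assoc]
              rw [← vx_mul_ed, ← mul_assoc, vx_mul_of_ne K G hr, zero_mul, zero_mul]
            rw [this, mul_zero]
            exact IsDiag.zero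
      · rw [gh_mul_ed_of_ne K G hef, zero_mul, mul_zero]
        exact IsDiag.zero

theorem ghProd_mul_vx (e : E) (p : List E) (v : V) :
    ghProd K G (e :: p) * vx K G v = if G.s e = v then ghProd K G (e :: p) else 0 := by
  rw [ghProd, mul_assoc]
  split_ifs with h
  · rw [← h, gh_mul_vx]
  · rw [← gh_mul_vx, mul_assoc, vx_mul_of_ne K G h, mul_zero, mul_zero]

/-- The letters of the word are absorbed one at a time into the ghost path on the left: a ghost edge
lengthens it, an edge cancels or kills it, a vertex is neutral or kills it. The degree condition
makes both sides equally long when the word is exhausted. -/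
theorem exists_isDiag_word (l : List (LPAGen V E)) : ∃ N : ℕ, ∀ p q : List E,
    N ≤ p.length → N ≤ q.length → (p.length : ℤ) = q.length + (l.map degree).sum →
      IsDiag K G (ghProd K G p * (l.map (gen K G)).prod * edProd K G q) := by
  induction l with
  | nil =>
    refine ⟨0, fun p q _ _ h => ?_⟩
    rw [List.map_nil, List.prod_nil, mul_one]
    exact isDiag_ghProd_mul_edProd p q (by simpa using h)
  | cons g l ih =>
    obtain ⟨N, hN⟩ := ih
    -- Cancelling an edge costs one unit of length and leaves the vertex `r(e)`; the second unit
    -- guarantees a further ghost edge that absorbs it, even if `N = 0`.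
    refine ⟨N + 2, fun p q hp hq h => ?_⟩
    obtain _ | ⟨e, p⟩ := p
    · simp at hp
    rw [List.map_cons, List.prod_cons, ← mul_assoc]
    simp only [List.map_cons, List.sum_cons, List.length_cons] at h hp hq
    cases g with
    | vertex v =>
      change IsDiag K G (ghProd K G (e :: p) * vx K G v * _ * _)
      rw [ghProd_mul_vx]
      split_ifs with hv
      · exact hN _ _ (by simp; omega) (by omega) (by simpa [degree] using h)
      · rw [zero_mul, zero_mul]
        exact IsDiag.zero
    | edge f =>
      change IsDiag K G (ghProd K G (e :: p) * ed K G f * _ * _)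
      rw [ghProd, mul_assoc (ghProd K G p)]
      by_cases hef : e = f
      · rw [← hef, gh_mul_ed_self]
        obtain _ | ⟨e', p⟩ := p
        · simp at hp
        rw [ghProd_mul_vx]
        split_ifs with hv
        · refine hN _ _ (by omega) (by omega) ?_
          simp [degree] at h ⊢
          omega
        · rw [zero_mul, zero_mul]
          exact IsDiag.zero
      · rw [gh_mul_ed_of_ne K G hef, mul_zero, zero_mul, zero_mul]
        exact IsDiag.zero
    | ghost f =>
      change IsDiag K G (ghProd K G (f :: e :: p) * _ * _)
      refine hN _ _ (by simp; omega) (by omega) ?_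
      simp [degree] at h ⊢
      omega

theorem IsDiagAt.succ {n : ℕ} {x : LPA K G} (hx : IsDiagAt K G (n + 1) x) (e f : E) :
    IsDiagAt K G n (gh K G e * x * ed K G f) := by
  intro p q hp hq
  have h := hx (e :: p) (f :: q) (by simp [hp]) (by simp [hq])
  simpa only [ghProd, edProd, List.map_cons, List.prod_cons, mul_assoc] using h

theorem IsDiagAt.isDiag {x : LPA K G} (hx : IsDiagAt K G 0 x) : IsDiag K G x := by
  simpa [ghProd, edProd] using hx [] [] rfl rfl

/-- The bound holds for all larger `n` as well, so that finitely many elements can be compressed at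
a common length. -/
theorem exists_isDiagAt {x : LPA K G} (hx : x ∈ grading K G 0) :
    ∃ N : ℕ, ∀ n, N ≤ n → IsDiagAt K G n x := by
  induction hx using Submodule.span_induction with
  | mem x h =>
    obtain ⟨l, hl, rfl⟩ := h
    obtain ⟨N, hN⟩ := exists_isDiag_word (K := K) (G := G) l
    exact ⟨N, fun n hn p q hp hq => hN p q (by omega) (by omega) (by omega)⟩
  | zero => exact ⟨0, fun n _ p q _ _ => by simpa using IsDiag.zero⟩
  | add x y _ _ hx hy =>
    obtain ⟨N, hN⟩ := hx
    obtain ⟨M, hM⟩ := hy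
    refine ⟨max N M, fun n hn p q hp hq => ?_⟩
    rw [mul_add, add_mul]
    exact (hN n (by omega) p q hp hq).add (hM n (by omega) p q hp hq)
  | smul c x _ hx =>
    obtain ⟨N, hN⟩ := hx
    refine ⟨N, fun n hn p q hp hq => ?_⟩
    rw [mul_smul_comm, smul_mul_assoc]
    exact (hN n hn p q hp hq).smul c

theorem exists_isDiagAt_family {ι : Type*} [Finite ι] (x : ι → LPA K G)
    (hx : ∀ i, x i ∈ grading K G 0) : ∃ N : ℕ, ∀ n, N ≤ n → ∀ i, IsDiagAt K G n (x i) := by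
  choose N hN using fun i => exists_isDiagAt (hx i)
  obtain ⟨M, hM⟩ := (Set.finite_range N).bddAbove
  exact ⟨M, fun n hn i => hN i n ((hM ⟨i, rfl⟩).trans hn)⟩

end LPA

namespace LPA

variable {V : Type u} {E : Type v} [Fintype V] [Fintype E] [DecidableEq V]
variable {K : Type w} [Field K] {G : DirectedGraph V E}

open scoped RightActions

/-! ### Frames of graded modules -/

theorem rsmul_rsmul {M : Type*} [AddCommGroup M] [Module (LPA K G)ᵐᵒᵖ M] (m : M)
    (a b : LPA K G) : (m <• a) <• b = m <• (a * b) := by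
  rw [smul_smul, ← MulOpposite.op_mul]

theorem sum_rsmul {M : Type*} [AddCommGroup M] [Module (LPA K G)ᵐᵒᵖ M] {ι : Type*}
    (s : Finset ι) (m : M) (a : ι → LPA K G) : m <• (∑ i ∈ s, a i) = ∑ i ∈ s, m <• a i := by
  rw [← Finset.sum_smul, Finset.op_sum]

theorem map_rsmul {M : Type*} [AddCommGroup M] [Module (LPA K G)ᵐᵒᵖ M]
    (f : M →ₗ[(LPA K G)ᵐᵒᵖ] LPA K G) (m : M) (a : LPA K G) : f (m <• a) = f m * a := by
  rw [map_smul]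
  rfl

/-- A finite family of homogeneous elements `b j` of degree `k` with `b j = b j * v j`, together
with coordinate functionals `c j` with values in `v j * L_K(E)` that satisfy `x = ∑ b j * c j x`. -/
structure PreFrame (P : GrModule (grading K G)) (k : ℤ) {ι : Type y} [Fintype ι]
    (v : ι → V) where
  b : ι → P.carrier
  c : ι → P.carrier →ₗ[(LPA K G)ᵐᵒᵖ] LPA K G
  b_mem : ∀ j, b j ∈ P.deg k
  c_mem : ∀ j i x, x ∈ P.deg i → c j x ∈ grading K G (i - k)
  b_vx : ∀ j, b j <• vx K G (v j) = b j
  vx_c : ∀ j x, vx K G (v j) * c j x = c j x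
  sum_eq : ∀ x, ∑ j, b j <• c j x = x

namespace PreFrame

variable {P Q : GrModule (grading K G)} {k : ℤ} {ι : Type y} [Fintype ι] {v : ι → V}
  {κ : Type x} [Fintype κ] {t : κ → V}

/-- A frame is a pre-frame whose elements and functionals are dual to each other; it exhibits the
module as the direct sum of shifts of the modules `v j * L_K(E)`. -/
def IsDual (F : PreFrame P k v) : Prop :=
  (∀ i, F.c i (F.b i) = vx K G (v i)) ∧ ∀ i j, i ≠ j → F.c i (F.b j) = 0

/-- For `f` a coordinate functional of another pre-frame, this is the composition rule for
transition matrices. -/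
theorem map_sum_eq (F : PreFrame P k v) (f : P.carrier →ₗ[(LPA K G)ᵐᵒᵖ] LPA K G)
    (x : P.carrier) : ∑ j, f (F.b j) * F.c j x = f x := by
  conv_rhs => rw [← F.sum_eq x, map_sum]
  simp only [map_rsmul]

theorem c_b_mem (F : PreFrame P k v) (F' : PreFrame P k t) (i : ι) (j : κ) :
    F.c i (F'.b j) ∈ grading K G 0 := by
  simpa using F.c_mem i k _ (F'.b_mem j)

theorem map_b_mul_vx (F : PreFrame P k v) (f : P.carrier →ₗ[(LPA K G)ᵐᵒᵖ] LPA K G) (j : ι) :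
    f (F.b j) * vx K G (v j) = f (F.b j) := by
  rw [← map_rsmul, F.b_vx]

/-- Change of the index type along a bijection. -/
def reindex (F : PreFrame P k v) (e : κ ≃ ι) (h : ∀ j, v (e j) = t j) : PreFrame P k t where
  b j := F.b (e j)
  c j := F.c (e j)
  b_mem j := F.b_mem _
  c_mem j := F.c_mem _
  b_vx j := by rw [← h, F.b_vx]
  vx_c j x := by rw [← h, F.vx_c]
  sum_eq x := (e.sum_comp fun j => F.b j <• F.c j x).trans (F.sum_eq x)

theorem IsDual.reindex {F : PreFrame P k v} (hF : F.IsDual) (e : κ ≃ ι)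
    (h : ∀ j, v (e j) = t j) : (F.reindex e h).IsDual :=
  ⟨fun i => (hF.1 (e i)).trans (by rw [h]), fun _ _ hij => hF.2 _ _ fun h' => hij (e.injective h')⟩

/-- Transport along a graded isomorphism. -/
def transport (F : PreFrame P k v) (e : P.carrier ≃ₗ[(LPA K G)ᵐᵒᵖ] Q.carrier)
    (he : GrModule.IsGradedHom (M := P) (N := Q) e.toLinearMap) : PreFrame Q k v where
  b j := e (F.b j)
  c j := F.c j ∘ₗ e.symm.toLinearMap
  b_mem j := he k _ (F.b_mem j)
  c_mem j i x hx := F.c_mem j i _ (GrModule.isGradedHom_symm e he i x hx)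
  b_vx j := by rw [← map_smul, F.b_vx]
  vx_c j x := F.vx_c j _
  sum_eq x := by
    have := congrArg e (F.sum_eq (e.symm x))
    rw [map_sum, LinearEquiv.apply_symm_apply] at this
    simp only [map_smul] at this
    exact this

theorem IsDual.transport {F : PreFrame P k v} (hF : F.IsDual)
    (e : P.carrier ≃ₗ[(LPA K G)ᵐᵒᵖ] Q.carrier)
    (he : GrModule.IsGradedHom (M := P) (N := Q) e.toLinearMap) : (F.transport e he).IsDual := by
  have h (i j : ι) : (F.transport e he).c i ((F.transport e he).b j) = F.c i (F.b j) :=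
    congrArg (F.c i) (e.symm_apply_apply (F.b j))
  exact ⟨fun i => (h i i).trans (hF.1 i), fun i j hij => (h i j).trans (hF.2 i j hij)⟩

/-- The pre-frame of a retract. -/
def retract (F : PreFrame P k v) (g : P.carrier →ₗ[(LPA K G)ᵐᵒᵖ] Q.carrier)
    (h : Q.carrier →ₗ[(LPA K G)ᵐᵒᵖ] P.carrier) (hg : GrModule.IsGradedHom (M := P) (N := Q) g)
    (hh : GrModule.IsGradedHom (M := Q) (N := P) h) (hgh : ∀ x, g (h x) = x) :
    PreFrame Q k v where
  b j := g (F.b j)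
  c j := F.c j ∘ₗ h
  b_mem j := hg k _ (F.b_mem j)
  c_mem j i x hx := F.c_mem j i _ (hh i x hx)
  b_vx j := by rw [← map_smul, F.b_vx]
  vx_c j x := F.vx_c j _
  sum_eq x := by
    have := congrArg g (F.sum_eq (h x))
    rw [map_sum, hgh] at this
    simp only [map_smul] at this
    exact this

/-- The sum of two pre-frames. -/
noncomputable def prod (F : PreFrame P k v) (F' : PreFrame Q k t) : PreFrame (P.prod Q) k (Sum.elim v t) where
  b := Sum.elim (fun j => (F.b j, 0)) fun j => (0, F'.b j)
  c := Sum.elim (fun j => F.c j ∘ₗ LinearMap.fst _ P.carrier Q.carrier)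
    fun j => F'.c j ∘ₗ LinearMap.snd _ P.carrier Q.carrier
  b_mem := by
    rintro (j | j)
    · exact ⟨F.b_mem j, (Q.deg k).zero_mem⟩
    · exact ⟨(P.deg k).zero_mem, F'.b_mem j⟩
  c_mem := by
    rintro (j | j) i x hx
    · exact F.c_mem j i _ hx.1
    · exact F'.c_mem j i _ hx.2
  b_vx := by
    rintro (j | j)
    · exact Prod.ext (F.b_vx j) (smul_zero _)
    · exact Prod.ext (smul_zero _) (F'.b_vx j)
  vx_c := by
    rintro (j | j) x
    · exact F.vx_c j _
    · exact F'.vx_c j _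
  sum_eq := by
    intro (x : P.carrier × Q.carrier)
    have h1 (j : ι) : ((F.b j, 0) : P.carrier × Q.carrier) <• F.c j x.1 =
        LinearMap.inl (LPA K G)ᵐᵒᵖ P.carrier Q.carrier (F.b j <• F.c j x.1) := by
      rw [map_smul]; rfl
    have h2 (j : κ) : ((0, F'.b j) : P.carrier × Q.carrier) <• F'.c j x.2 =
        LinearMap.inr (LPA K G)ᵐᵒᵖ P.carrier Q.carrier (F'.b j <• F'.c j x.2) := by
      rw [map_smul]; rfl
    rw [Fintype.sum_sum_type]
    change ∑ j, ((F.b j, 0) : P.carrier × Q.carrier) <• F.c j x.1 +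
      ∑ j, ((0, F'.b j) : P.carrier × Q.carrier) <• F'.c j x.2 = x
    simp only [h1, h2]
    rw [← map_sum, ← map_sum, F.sum_eq, F'.sum_eq]
    simp

theorem IsDual.prod {F : PreFrame P k v} (hF : F.IsDual) {F' : PreFrame Q k t}
    (hF' : F'.IsDual) : (F.prod F').IsDual := by
  constructor
  · rintro (i | i)
    · exact hF.1 i
    · exact hF'.1 i
  · rintro (i | i) (j | j) hij
    · exact hF.2 i j fun h => hij (congrArg _ h)
    · exact map_zero (F.c i)
    · exact map_zero (F'.c i)
    · exact hF'.2 i j fun h => hij (congrArg _ h)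

/-- A pre-frame of the shifted module. -/
def shift (F : PreFrame P k v) {l δ : ℤ} (h : δ + l = k) : PreFrame (P.shift δ) l v where
  b := F.b
  c := F.c
  b_mem j := by
    change F.b j ∈ P.deg (δ + l)
    rw [h]
    exact F.b_mem j
  c_mem j i x hx := by
    have := F.c_mem j (δ + i) x hx
    rwa [show δ + i - k = i - l by omega] at this
  b_vx := F.b_vx
  vx_c := F.vx_c
  sum_eq := F.sum_eq

theorem IsDual.shift {F : PreFrame P k v} (hF : F.IsDual) {l δ : ℤ} (h : δ + l = k) :
    (F.shift h).IsDual := hF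

theorem sum_subtype_prod {M : Type*} [AddCommMonoid M] (f : ι → E → M) :
    ∑ x : {x : ι × E // G.s x.2 = v x.1}, f x.1.1 x.1.2 =
      ∑ j, ∑ e ∈ Finset.univ.filter (fun e => G.s e = v j), f j e := by
  rw [← Finset.sum_subtype (Finset.univ.filter fun x : ι × E => G.s x.2 = v x.1) (by simp)
    fun x : ι × E => f x.1 x.2, Finset.sum_filter, Fintype.sum_prod_type]
  simp only [Finset.sum_filter]

/-- The refinement of a pre-frame by the decomposition of every `v j * L_K(E)` as the direct sum
of the modules `e * L_K(E)`, where `e` runs over the edges with source `v j`. -/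
noncomputable def refine (hG : G.NoSinks) (F : PreFrame P k v) :
    PreFrame P (k + 1) fun x : {x : ι × E // G.s x.2 = v x.1} => G.r x.1.2 where
  b x := F.b x.1.1 <• ed K G x.1.2
  c x := leftMul K G (gh K G x.1.2) ∘ₗ F.c x.1.1
  b_mem x := P.smul_mem (F.b_mem _) (ed_mem K G _)
  c_mem x i m hm := mul_mem K G (gh_mem K G _) (F.c_mem _ i m hm) (by ring)
  b_vx x := by rw [rsmul_rsmul, ed_mul_vx]
  vx_c x m := by
    change vx K G _ * (gh K G _ * _) = gh K G _ * _
    rw [← mul_assoc, vx_mul_gh]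
  sum_eq m := by
    have h (x : {x : ι × E // G.s x.2 = v x.1}) :
        (F.b x.1.1 <• ed K G x.1.2) <• (leftMul K G (gh K G x.1.2) ∘ₗ F.c x.1.1) m =
        F.b x.1.1 <• (ed K G x.1.2 * gh K G x.1.2 * F.c x.1.1 m) := by
      rw [rsmul_rsmul, mul_assoc]; rfl
    simp only [h]
    rw [sum_subtype_prod (v := v) fun j e => F.b j <• (ed K G e * gh K G e * F.c j m)]
    simp only [← sum_rsmul, ← Finset.sum_mul, sum_ed_mul_gh K G hG, F.vx_c]
    exact F.sum_eq m

/-- Refinement compresses the transition matrix by one edge on each side, the step that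
`IsDiagAt.succ` tracks. -/
theorem refine_c_b (hG : G.NoSinks) (F : PreFrame P k v) (F' : PreFrame P k t)
    (i : {x : ι × E // G.s x.2 = v x.1}) (j : {x : κ × E // G.s x.2 = t x.1}) :
    (F.refine hG).c i ((F'.refine hG).b j) =
      gh K G i.1.2 * F.c i.1.1 (F'.b j.1.1) * ed K G j.1.2 := by
  change gh K G _ * F.c _ (F'.b _ <• ed K G _) = _
  rw [map_rsmul, mul_assoc]

theorem IsDual.refine (hG : G.NoSinks) {F : PreFrame P k v} (hF : F.IsDual) :
    (F.refine hG).IsDual := by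
  constructor
  · intro i
    rw [refine_c_b, hF.1, ← i.2, gh_mul_vx, gh_mul_ed_self]
  · rintro ⟨⟨i, e⟩, hi⟩ ⟨⟨j, f⟩, hj⟩ hij
    rw [refine_c_b]
    dsimp only at hi hj ⊢
    by_cases h : i = j
    · subst h
      rw [hF.1, ← hi, gh_mul_vx, gh_mul_ed_of_ne]
      rintro rfl
      exact hij rfl
    · rw [hF.2 i j h, mul_zero, zero_mul]

end PreFrame

/-! ### Colour counts -/

/-- The number of indices of each colour. -/
def colorCount {ι : Type*} [Fintype ι] (v : ι → V) (u : V) : ℤ :=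
  ((Finset.univ.filter fun j => v j = u).card : ℤ)

theorem colorCount_nonneg {ι : Type*} [Fintype ι] (v : ι → V) : 0 ≤ colorCount v :=
  fun _ => Int.natCast_nonneg _

theorem colorCount_comp {ι κ : Type*} [Fintype ι] [Fintype κ] (v : ι → V) (e : κ ≃ ι) :
    colorCount (v ∘ e) = colorCount v := by
  funext u
  simp only [colorCount, Finset.natCast_card_filter, Function.comp_apply]
  exact e.sum_comp fun j => if v j = u then (1 : ℤ) else 0

theorem colorCount_sumElim {ι κ : Type*} [Fintype ι] [Fintype κ] (v : ι → V) (t : κ → V) :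
    colorCount (Sum.elim v t) = colorCount v + colorCount t := by
  funext u
  simp only [colorCount, Finset.natCast_card_filter, Fintype.sum_sum_type, Sum.elim_inl,
    Sum.elim_inr, Pi.add_apply]
  rfl

/-- An index of colour `u` is replaced by the edges with source `u`, of which `n_{u,w}` have colour
`w`; hence the transpose. -/
theorem colorCount_refine {ι : Type*} [Fintype ι] (v : ι → V) :
    colorCount (fun x : {x : ι × E // G.s x.2 = v x.1} => G.r x.1.2) =
      G.adjMatrixᵀ *ᵥ colorCount v := by
  funext w
  simp only [colorCount, Finset.natCast_card_filter, Matrix.mulVec, dotProduct,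
    Matrix.transpose_apply, DirectedGraph.adjMatrix, Matrix.of_apply]
  rw [PreFrame.sum_subtype_prod (v := v) fun _ e => if G.r e = w then (1 : ℤ) else 0]
  simp only [Finset.mul_sum]
  rw [Finset.sum_comm]
  refine Finset.sum_congr rfl fun j _ => ?_
  rw [Finset.sum_filter]
  simp [ite_and, -Finset.sum_boole]

theorem exists_equiv_of_colorCount_eq {ι κ : Type*} [Fintype ι] [Fintype κ] {v : ι → V}
    {t : κ → V} (h : colorCount v = colorCount t) : ∃ e : ι ≃ κ, ∀ i, t (e i) = v i := by
  have h' (u : V) : Nonempty ({i // v i = u} ≃ {j // t j = u}) := by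
    rw [← Fintype.card_eq, Fintype.card_subtype, Fintype.card_subtype]
    exact Int.natCast_inj.1 (congrFun h u)
  let f u := Classical.choice (h' u)
  refine ⟨(Equiv.sigmaFiberEquiv v).symm.trans
    ((Equiv.sigmaCongrRight f).trans (Equiv.sigmaFiberEquiv t)), fun i => ?_⟩
  exact (f (v i) ⟨i, rfl⟩).2

namespace PreFrame

variable {P Q : GrModule (grading K G)} {k : ℤ} {ι : Type y} [Fintype ι] {v : ι → V}
  {κ : Type x} [Fintype κ] {t : κ → V}

/-! ### Uniqueness of the colour count of a frame -/

/-- The entry already lies in the corner `v_i L t_j`, so diagonality makes it a scalar multiple of a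
vertex. -/
theorem exists_coeff (F : PreFrame P k v) (F' : PreFrame P k t) {i : ι} {j : κ}
    (h : IsDiag K G (F.c i (F'.b j))) :
    ∃ a : K, F.c i (F'.b j) = if v i = t j then a • vx K G (v i) else 0 := by
  obtain ⟨a, ha⟩ := h (v i) (t j)
  rw [F.vx_c, F'.map_b_mul_vx] at ha
  exact ⟨a, ha⟩

theorem sum_mul_eq_smul_vx (v : ι → V) (u : V) {x z : ι → LPA K G} {a b : ι → K}
    (hx : ∀ j, x j = if v j = u then a j • vx K G u else 0)
    (hz : ∀ j, z j = if v j = u then b j • vx K G u else 0) :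
    ∑ j, x j * z j = (∑ j : {j // v j = u}, a j * b j) • vx K G u := by
  rw [← Finset.sum_subtype (Finset.univ.filter fun j => v j = u) (by simp) fun j => a j * b j,
    Finset.sum_filter, Finset.sum_smul]
  refine Finset.sum_congr rfl fun j _ => ?_
  rw [hx, hz]
  split_ifs
  · rw [smul_mul_assoc, mul_smul_comm, vx_mul_self, smul_smul]
  · rw [zero_mul, zero_smul]

/-- Composing the two changes of frame gives `c_i(b_l)`, which is `δ_{il} u` by duality. Only
intermediate indices of colour `u` contribute, and `u ≠ 0` allows the scalars to be compared. -/
theorem matrix_mul_eq_one (hG : G.NoSinks) {F : PreFrame P k v} (hF : F.IsDual)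
    (F' : PreFrame P k t) {a : ι → κ → K} {b : κ → ι → K}
    (ha : ∀ i j, F.c i (F'.b j) = if v i = t j then a i j • vx K G (v i) else 0)
    (hb : ∀ j i, F'.c j (F.b i) = if t j = v i then b j i • vx K G (t j) else 0)
    [DecidableEq ι] (u : V) :
    (Matrix.of fun (i : {i // v i = u}) (j : {j // t j = u}) => a i j) *
      (Matrix.of fun (j : {j // t j = u}) (i : {i // v i = u}) => b j i) = 1 := by
  ext ⟨i, hi⟩ ⟨l, hl⟩
  apply smul_left_injective K (vx_ne_zero K hG u)
  dsimp only
  have h := F'.map_sum_eq (F.c i) (F.b l)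
  rw [sum_mul_eq_smul_vx t u (a := a i) (b := fun j => b j l)
    (fun j => by rw [ha, hi]; simp only [eq_comm])
    (fun j => by rw [hb, hl]; split_ifs with h1 <;> simp [h1])] at h
  rw [Matrix.mul_apply]
  refine h.trans ?_
  by_cases hil : i = l
  · subst hil
    rw [hF.1, hi, Matrix.one_apply_eq, one_smul]
  · rw [hF.2 i l hil, Matrix.one_apply_ne (fun h => hil (congrArg Subtype.val h)), zero_smul]

/-- For each colour the two scalar blocks are inverse to each other, and an invertible matrix over a
field is square. -/
theorem colorCount_eq_of_isDiag (hG : G.NoSinks) {F : PreFrame P k v} (hF : F.IsDual)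
    {F' : PreFrame P k t} (hF' : F'.IsDual) (h : ∀ i j, IsDiag K G (F.c i (F'.b j)))
    (h' : ∀ j i, IsDiag K G (F'.c j (F.b i))) : colorCount v = colorCount t := by
  classical
  choose a ha using fun i j => F.exists_coeff F' (h i j)
  choose b hb using fun j i => F'.exists_coeff F (h' j i)
  funext u
  have := Matrix.square_of_invertible _ _ (matrix_mul_eq_one hG hF F' ha hb u)
    (matrix_mul_eq_one hG hF' F hb ha u)
  rw [Fintype.card_subtype, Fintype.card_subtype] at this
  exact congrArg Nat.cast this

/-- Each refinement trades one unit of `n` for one factor `A^t`. The index types live in the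
universe of `E`, which refinement preserves, so the induction closes. -/
theorem pow_mulVec_colorCount_eq_of_isDiagAt (hG : G.NoSinks) (n : ℕ) {k : ℤ} {ι κ : Type v}
    [Fintype ι] [Fintype κ] {v : ι → V} {t : κ → V} {F : PreFrame P k v} (hF : F.IsDual)
    {F' : PreFrame P k t} (hF' : F'.IsDual) (h : ∀ i j, IsDiagAt K G n (F.c i (F'.b j)))
    (h' : ∀ j i, IsDiagAt K G n (F'.c j (F.b i))) :
    (G.adjMatrixᵀ ^ n) *ᵥ colorCount v = (G.adjMatrixᵀ ^ n) *ᵥ colorCount t := by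
  induction n generalizing k ι κ with
  | zero =>
    rw [colorCount_eq_of_isDiag hG hF hF' (fun i j => (h i j).isDiag) fun j i => (h' j i).isDiag]
  | succ n ih =>
    rw [pow_succ, ← Matrix.mulVec_mulVec, ← Matrix.mulVec_mulVec, ← colorCount_refine,
      ← colorCount_refine]
    refine ih (hF.refine hG) (hF'.refine hG) (fun i j => ?_) fun j i => ?_
    · rw [refine_c_b]
      exact (h _ _).succ _ _
    · rw [refine_c_b]
      exact (h' _ _).succ _ _

theorem exists_pow_mulVec_colorCount_eq (hG : G.NoSinks) {ι κ : Type v}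
    [Fintype ι] [Fintype κ] {v : ι → V} {t : κ → V} {F : PreFrame P k v} (hF : F.IsDual)
    {F' : PreFrame P k t} (hF' : F'.IsDual) : ∃ n : ℕ,
    (G.adjMatrixᵀ ^ n) *ᵥ colorCount v = (G.adjMatrixᵀ ^ n) *ᵥ colorCount t := by
  obtain ⟨N, hN⟩ := exists_isDiagAt_family (fun x : ι × κ => F.c x.1 (F'.b x.2))
    fun x => F.c_b_mem F' _ _
  obtain ⟨M, hM⟩ := exists_isDiagAt_family (fun x : κ × ι => F'.c x.1 (F.b x.2))
    fun x => F'.c_b_mem F _ _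
  exact ⟨max N M, pow_mulVec_colorCount_eq_of_isDiagAt hG _ hF hF'
    (fun i j => hN _ (le_max_left _ _) (i, j)) fun j i => hM _ (le_max_right _ _) (j, i)⟩

/-! ### Frames from pre-frames -/

theorem exists_isDiag_of_isDiagAt (hG : G.NoSinks) (n : ℕ) {k : ℤ} {ι : Type v} [Fintype ι]
    {v : ι → V} (F : PreFrame P k v) (h : ∀ i j, IsDiagAt K G n (F.c i (F.b j))) :
    ∃ (ι' : Type v) (_ : Fintype ι') (v' : ι' → V) (F' : PreFrame P (k + n) v'),
      ∀ i j, IsDiag K G (F'.c i (F'.b j)) := by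
  induction n generalizing k ι with
  | zero =>
    rw [Nat.cast_zero, add_zero]
    exact ⟨ι, _, v, F, fun i j => (h i j).isDiag⟩
  | succ n ih =>
    obtain ⟨ι', _, v', F', hF'⟩ := ih (F.refine hG) fun i j => by
      rw [refine_c_b]
      exact (h _ _).succ _ _
    rw [Nat.cast_succ, add_comm (n : ℤ), ← add_assoc]
    exact ⟨ι', _, v', F', hF'⟩

end PreFrame

/-- An idempotent matrix over a field factors through its rank. -/
theorem exists_factorization_of_isIdempotent {n : Type*} [Fintype n] [DecidableEq n]
    (X : Matrix n n K) (hX : X * X = X) :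
    ∃ (r : ℕ) (R : Matrix n (Fin r) K) (S : Matrix (Fin r) n K), R * S = X ∧ S * R = 1 := by
  let f := Matrix.toLin' X
  let b := Module.finBasis K (LinearMap.range f)
  refine ⟨_, LinearMap.toMatrix b (Pi.basisFun K n) (LinearMap.range f).subtype,
    LinearMap.toMatrix (Pi.basisFun K n) b f.rangeRestrict, ?_, ?_⟩
  · rw [← LinearMap.toMatrix_comp]
    change LinearMap.toMatrix _ _ f = X
    rw [LinearMap.toMatrix_eq_toMatrix', LinearMap.toMatrix'_toLin']
  · rw [← LinearMap.toMatrix_comp, ← LinearMap.toMatrix_id b]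
    congr 1
    refine LinearMap.ext fun z => Subtype.ext ?_
    obtain ⟨_, y, rfl⟩ := z
    change f (f y) = f y
    rw [← LinearMap.comp_apply, ← Matrix.toLin'_mul, hX]

end LPA

/-! ### Homogeneous lifts and images of graded idempotents -/

namespace GrModule

variable {Γ : Type x} [AddCommGroup Γ] [DecidableEq Γ]
variable {A : Type u} [Ring A] {σ : Type y} [SetLike σ A] [AddSubgroupClass σ A]
variable {𝒜 : Γ → σ} [GradedRing 𝒜]

/-- Homogeneous elements of the image of a graded homomorphism lift to homogeneous elements. -/
theorem exists_mem_deg_of_isGradedHom {M N : GrModule 𝒜} {g : M.carrier →ₗ[Aᵐᵒᵖ] N.carrier}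
    (hg : IsGradedHom g) {k : Γ} {m : M.carrier} (hm : g m ∈ N.deg k) :
    ∃ m' ∈ M.deg k, g m' = g m := by
  obtain ⟨z, hz⟩ := M.isInternal.2 m
  let f : ∀ i, M.deg i →+ N.deg i := fun i =>
    ((g : M.carrier →+ N.carrier).comp (M.deg i).subtype).codRestrict (N.deg i)
      fun p => hg i p p.2
  have h1 := coeAddMonoidHom_map_of_comm (g : M.carrier →+ N.carrier) f (fun _ _ => rfl) z
  rw [hz] at h1
  have h2 : DirectSum.map f z = DirectSum.of (fun i => N.deg i) k ⟨g m, hm⟩ := by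
    apply N.isInternal.1
    rw [h1]
    simp
  refine ⟨z k, (z k).2, ?_⟩
  have h3 := congrArg (fun t => (t k : N.carrier)) h2
  rw [DirectSum.map_apply, DirectSum.of_eq_same] at h3
  exact h3

/-- The image of a graded idempotent endomorphism. -/
def ofIdempotent (M : GrModule 𝒜) (e : M.carrier →ₗ[Aᵐᵒᵖ] M.carrier) (he : IsGradedHom e)
    (hee : ∀ m, e (e m) = e m) : GrModule 𝒜 where
  carrier := LinearMap.range e
  deg i := (M.deg i).comap (LinearMap.range e).subtype.toAddMonoidHom
  isInternal := by
    let N : Γ → AddSubgroup (LinearMap.range e) := fun i =>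
      (M.deg i).comap (LinearMap.range e).subtype.toAddMonoidHom
    let f : ∀ i, N i →+ M.deg i := fun i =>
      ((LinearMap.range e).subtype.toAddMonoidHom.comp (N i).subtype).codRestrict (M.deg i)
        fun p => p.2
    let g : ∀ i, M.deg i →+ N i := fun i =>
      (e.rangeRestrict.toAddMonoidHom.comp (M.deg i).subtype).codRestrict (N i)
        fun p => he i p p.2
    constructor
    · intro a b hab
      have h1 : DirectSum.map f a = DirectSum.map f b := by
        apply M.isInternal.1
        rw [coeAddMonoidHom_map_of_comm (LinearMap.range e).subtype.toAddMonoidHom f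
            (fun _ _ => rfl), hab,
          ← coeAddMonoidHom_map_of_comm (LinearMap.range e).subtype.toAddMonoidHom f
            (fun _ _ => rfl)]
      ext i : 1
      have h2 := congrArg (fun t => (t i : M.carrier)) h1
      simp only [DirectSum.map_apply] at h2
      exact Subtype.ext (Subtype.ext h2)
    · rintro ⟨_, m, rfl⟩
      obtain ⟨z, hz⟩ := M.isInternal.2 (e m)
      refine ⟨DirectSum.map g z, ?_⟩
      rw [coeAddMonoidHom_map_of_comm e.rangeRestrict.toAddMonoidHom g (fun _ _ => rfl), hz]
      exact Subtype.ext (hee m)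
  smul_mem hm ha := M.smul_mem hm ha

end GrModule

namespace LPA

variable {V : Type u} {E : Type v} [Fintype V] [Fintype E] [DecidableEq V]
variable {K : Type w} [Field K] {G : DirectedGraph V E}

open scoped RightActions

/-- The right linear map `a ↦ m a`. -/
def orbitMap {M : Type*} [AddCommGroup M] [Module (LPA K G)ᵐᵒᵖ M] (m : M) :
    LPA K G →ₗ[(LPA K G)ᵐᵒᵖ] M where
  toFun a := m <• a
  map_add' a b := by rw [MulOpposite.op_add, add_smul]
  map_smul' c a := by
    change m <• (a * c.unop) = (m <• a) <• c.unop
    rw [rsmul_rsmul]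

@[simp] theorem orbitMap_apply {M : Type*} [AddCommGroup M] [Module (LPA K G)ᵐᵒᵖ M] (m : M)
    (a : LPA K G) : orbitMap m a = m <• a := rfl

namespace PreFrame

variable {P Q : GrModule (grading K G)} {k : ℤ} {ι : Type y} [Fintype ι] {v : ι → V}

/-! ### Splitting a pre-frame with scalar transition matrix -/

section Diagonal

variable (F : PreFrame P k v) {a : ι → ι → K}

theorem sum_coeff_mul_c
    (ha : ∀ i j, F.c i (F.b j) = if v i = v j then a i j • vx K G (v i) else 0) {u : V} {i : ι}
    (hi : v i = u) (x : P.carrier) :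
    ∑ j : {j // v j = u}, (a i j • vx K G u) * F.c j x = F.c i x := by
  rw [← F.map_sum_eq (F.c i) x, ← Finset.sum_subtype (Finset.univ.filter fun j => v j = u)
    (by simp) fun j => (a i j • vx K G u) * F.c j x, Finset.sum_filter]
  refine Finset.sum_congr rfl fun j _ => ?_
  rw [ha, hi]
  simp only [eq_comm (a := u)]
  split_ifs
  · rfl
  · rw [zero_mul]

/-- Expanding `c_i(b_l)` through the pre-frame itself reproduces it; comparing coefficients of `u`
gives idempotency. -/
theorem coeff_isIdempotent (hG : G.NoSinks)
    (ha : ∀ i j, F.c i (F.b j) = if v i = v j then a i j • vx K G (v i) else 0) (u : V) :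
    (Matrix.of fun i j : {i // v i = u} => a i j) * (Matrix.of fun i j : {i // v i = u} => a i j) =
      Matrix.of fun i j : {i // v i = u} => a i j := by
  ext ⟨i, hi⟩ ⟨l, hl⟩
  apply smul_left_injective K (vx_ne_zero K hG u)
  have h := F.sum_coeff_mul_c ha hi (F.b l)
  rw [ha i l, hi, if_pos hl.symm] at h
  dsimp only [Matrix.of_apply]
  rw [← h, Matrix.mul_apply, Finset.sum_smul]
  refine Finset.sum_congr rfl fun j _ => ?_
  rw [ha, j.2, if_pos hl.symm, smul_mul_assoc, mul_smul_comm, vx_mul_self, smul_smul]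
  rfl

variable {r : V → ℕ} {R : ∀ u, Matrix {i // v i = u} (Fin (r u)) K}
  {S : ∀ u, Matrix (Fin (r u)) {i // v i = u} K}

/-- The pre-frame obtained from factorizations of the diagonal blocks of the transition matrix of
a pre-frame with itself. -/
noncomputable def factor
    (ha : ∀ i j, F.c i (F.b j) = if v i = v j then a i j • vx K G (v i) else 0)
    (hRS : ∀ u, R u * S u = Matrix.of fun i j : {i // v i = u} => a i j) :
    PreFrame P k fun x : Σ u, Fin (r u) => x.1 where
  b x := ∑ i : {i // v i = x.1}, F.b i <• (R x.1 i x.2 • vx K G x.1)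
  c x := ∑ i : {i // v i = x.1}, leftMul K G (S x.1 x.2 i • vx K G x.1) ∘ₗ F.c i
  b_mem x := sum_mem fun i _ => by
    have := P.smul_mem (F.b_mem i) (Submodule.smul_mem _ (R x.1 i x.2) (vx_mem K G x.1))
    rwa [add_zero] at this
  c_mem x i m hm := by
    rw [LinearMap.sum_apply]
    exact sum_mem fun j _ => mul_mem K G (Submodule.smul_mem _ _ (vx_mem K G x.1))
      (F.c_mem j i m hm) (zero_add _)
  b_vx x := by
    rw [Finset.smul_sum]
    refine Finset.sum_congr rfl fun i _ => ?_
    rw [rsmul_rsmul, smul_mul_assoc, vx_mul_self]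
  vx_c x m := by
    rw [LinearMap.sum_apply, Finset.mul_sum]
    refine Finset.sum_congr rfl fun i _ => ?_
    rw [LinearMap.comp_apply, leftMul_apply, ← mul_assoc, mul_smul_comm, vx_mul_self]
  sum_eq m := by
    have h1 (u : V) (i j : {i // v i = u}) : ∑ l, R u i l * S u l j = a i j := by
      rw [← Matrix.mul_apply, hRS, Matrix.of_apply]
    -- Within one colour the product `R S` is the coefficient block, which fixes the coordinates
    -- `c_i` by `sum_coeff_mul_c`.
    have h2 (u : V) : ∑ l : Fin (r u), (∑ i : {i // v i = u}, F.b i <• (R u i l • vx K G u)) <•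
        (∑ j : {j // v j = u}, (S u l j • vx K G u) * F.c j m) =
        ∑ i : {i // v i = u}, F.b i <• F.c i m := by
      simp only [Finset.smul_sum, rsmul_rsmul, Finset.mul_sum]
      rw [Finset.sum_comm]
      refine Finset.sum_congr rfl fun i _ => ?_
      rw [← sum_rsmul, ← F.sum_coeff_mul_c ha i.2 m, Finset.sum_comm]
      congr 2
      refine Finset.sum_congr rfl fun j _ => ?_
      rw [← h1 u i j, Finset.sum_smul, Finset.sum_mul]
      refine Finset.sum_congr rfl fun l _ => ?_
      rw [← mul_assoc, smul_mul_assoc, mul_smul_comm, vx_mul_self, smul_smul]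
    simp only [LinearMap.sum_apply, LinearMap.comp_apply, leftMul_apply]
    rw [Fintype.sum_sigma]
    simp only [h2]
    rw [Fintype.sum_fiberwise v fun i => F.b i <• F.c i m]
    exact F.sum_eq m

/-- Within one colour the new transition matrix is `S (R S) R = 1`. Between different colours it
vanishes because the old one does. -/
theorem isDual_factor
    (ha : ∀ i j, F.c i (F.b j) = if v i = v j then a i j • vx K G (v i) else 0)
    (hRS : ∀ u, R u * S u = Matrix.of fun i j : {i // v i = u} => a i j)
    (hSR : ∀ u, S u * R u = 1) : (F.factor ha hRS).IsDual := by
  have h (x z : Σ u, Fin (r u)) : (F.factor ha hRS).c x ((F.factor ha hRS).b z) =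
      ∑ i : {i // v i = x.1}, ∑ j : {j // v j = z.1},
        (S x.1 x.2 i • vx K G x.1) * (F.c i (F.b j) * (R z.1 j z.2 • vx K G z.1)) := by
    simp only [factor, LinearMap.sum_apply, LinearMap.comp_apply, leftMul_apply, map_sum,
      map_rsmul]
    exact Finset.sum_comm
  have h' (u : V) (l m : Fin (r u)) : (F.factor ha hRS).c ⟨u, l⟩ ((F.factor ha hRS).b ⟨u, m⟩) =
      (1 : Matrix (Fin (r u)) (Fin (r u)) K) l m • vx K G u := by
    have h1 : S u * ((Matrix.of fun i j : {i // v i = u} => a i j) * R u) = 1 := by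
      rw [← hRS, Matrix.mul_assoc, hSR, Matrix.mul_one, hSR]
    rw [h, ← h1, Matrix.mul_apply, Finset.sum_smul]
    refine Finset.sum_congr rfl fun i _ => ?_
    rw [Matrix.mul_apply, Finset.mul_sum, Finset.sum_smul]
    refine Finset.sum_congr rfl fun j _ => ?_
    rw [ha, i.2, j.2, if_pos rfl]
    simp only [smul_mul_assoc, mul_smul_comm, vx_mul_self, smul_smul, Matrix.of_apply]
    congr 1
    ring
  constructor
  · rintro ⟨u, l⟩
    rw [h', Matrix.one_apply_eq, one_smul]
  · rintro ⟨u, l⟩ ⟨w, m⟩ hne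
    by_cases huw : u = w
    · subst huw
      rw [h', Matrix.one_apply_ne (fun hlm => hne (by rw [hlm])), zero_smul]
    · rw [h]
      refine Finset.sum_eq_zero fun i _ => Finset.sum_eq_zero fun j _ => ?_
      rw [ha, if_neg (by rw [i.2, j.2]; exact huw), zero_mul, mul_zero]

theorem exists_isDual_of_isDiag (hG : G.NoSinks) (h : ∀ i j, IsDiag K G (F.c i (F.b j))) :
    ∃ (κ : Type u) (_ : Fintype κ) (t : κ → V) (F' : PreFrame P k t), F'.IsDual := by
  classical
  choose a ha using fun i j => F.exists_coeff F (h i j)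
  choose r R S hRS hSR using fun u =>
    exists_factorization_of_isIdempotent _ (F.coeff_isIdempotent hG ha u)
  exact ⟨_, _, _, F.factor ha hRS, F.isDual_factor ha hRS hSR⟩

end Diagonal

/-! ### Modules with pre-frames are graded projective -/

theorem isFG (F : PreFrame P k v) : P.IsFG := by
  refine ⟨Submodule.fg_def.2 ⟨Set.range F.b, Set.finite_range _, top_le_iff.1 fun x _ => ?_⟩⟩
  rw [← F.sum_eq x]
  exact sum_mem fun j _ => Submodule.smul_mem _ _ (Submodule.subset_span ⟨j, rfl⟩)

theorem isGradedHom_sum {M : GrModule (grading K G)} (F : PreFrame P k v) (m : ι → M.carrier)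
    (hm : ∀ j, m j ∈ M.deg k) :
    GrModule.IsGradedHom (M := P) (N := M) (∑ j, orbitMap (m j) ∘ₗ F.c j) := by
  intro i x hx
  rw [LinearMap.sum_apply]
  refine sum_mem fun j _ => ?_
  have := M.smul_mem (hm j) (F.c_mem j i x hx)
  rwa [add_sub_cancel] at this

/-- A lift is `∑ m_i c_i` with `m_i` any lift of `j(b_i)` in degree `k`. No condition `m_i v_i =
m_i` is needed, and duality plays no role. -/
theorem isGradedProjective (F : PreFrame P k v) : P.IsGradedProjective := by
  intro M N g j hg hs hj
  have h (i : ι) : ∃ m ∈ M.deg k, g m = j (F.b i) := by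
    obtain ⟨m, hm⟩ := hs (j (F.b i))
    obtain ⟨m', hm', h⟩ := GrModule.exists_mem_deg_of_isGradedHom hg (k := k) (m := m)
      (hm ▸ hj k _ (F.b_mem i))
    exact ⟨m', hm', h.trans hm⟩
  choose m hm hgm using h
  refine ⟨∑ i, orbitMap (m i) ∘ₗ F.c i, F.isGradedHom_sum m hm, LinearMap.ext fun x => ?_⟩
  conv_rhs => rw [← F.sum_eq x]
  simp [hgm]

/-! ### Frames with equal colours -/

/-- The maps `∑ b'_j c_j` and `∑ b_j c'_j` are mutually inverse; each composite is the identity by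
duality of the intermediate frame. -/
theorem isIso_of_isDual {F : PreFrame P k v} (hF : F.IsDual) {F' : PreFrame Q k v}
    (hF' : F'.IsDual) : P.IsIso Q := by
  have key {P Q : GrModule (grading K G)} (F : PreFrame P k v) {F' : PreFrame Q k v}
      (hF' : F'.IsDual) : (∑ j, orbitMap (F.b j) ∘ₗ F'.c j) ∘ₗ
        (∑ j, orbitMap (F'.b j) ∘ₗ F.c j) = LinearMap.id := by
    refine LinearMap.ext fun x => ?_
    simp only [LinearMap.comp_apply, LinearMap.sum_apply, map_sum, orbitMap_apply, map_rsmul,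
      LinearMap.id_apply]
    conv_rhs => rw [← F.sum_eq x]
    refine Finset.sum_congr rfl fun i _ => ?_
    rw [Finset.sum_eq_single i, hF'.1, F.vx_c]
    · intro j _ hji
      rw [hF'.2 j i hji, zero_mul, MulOpposite.op_zero, zero_smul]
    · exact fun h => absurd (Finset.mem_univ i) h
  exact ⟨LinearEquiv.ofLinearMap _ _ (key F' hF) (key F hF'), F.isGradedHom_sum _ F'.b_mem⟩

theorem isIso_of_colorCount_eq {κ : Type x} [Fintype κ] {t : κ → V} {F : PreFrame P k v}
    (hF : F.IsDual) {F' : PreFrame Q k t} (hF' : F'.IsDual)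
    (h : colorCount v = colorCount t) : P.IsIso Q := by
  obtain ⟨e, he⟩ := exists_equiv_of_colorCount_eq h
  exact isIso_of_isDual hF (hF'.reindex e he)

end PreFrame

/-! ### Existence of frames -/

variable (K G)

/-- The regular graded module `L_K(E)`. -/
noncomputable def regular : GrModule (grading K G) where
  carrier := LPA K G
  deg i := (grading K G i).toAddSubgroup
  isInternal := DirectSum.Decomposition.isInternal (grading K G)
  smul_mem hm ha := mul_mem K G hm ha rfl

/-- The pre-frame of the regular module given by the vertices. -/
noncomputable def regularFrame : PreFrame (regular K G) 0 (id : V → V) where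
  b v := vx K G v
  c v := leftMul K G (vx K G v)
  b_mem v := vx_mem K G v
  c_mem v i x hx := mul_mem K G (vx_mem K G v) hx (by ring)
  b_vx v := vx_mul_self K G v
  vx_c := fun v (x : LPA K G) => by
    change vx K G v * (vx K G v * x) = vx K G v * x
    rw [← mul_assoc, vx_mul_self]
  sum_eq := fun (x : LPA K G) => by
    change ∑ v, vx K G v * (vx K G v * x) = x
    simp only [← mul_assoc, vx_mul_self]
    rw [← Finset.sum_mul, sum_vx, one_mul]

/-- The graded module `v L_K(E)`. -/
noncomputable def vertexModule (v : V) : GrModule (grading K G) :=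
  (regular K G).ofIdempotent (leftMul K G (vx K G v))
    (fun _ _ hm => mul_mem K G (vx_mem K G v) hm (zero_add _))
    (fun (m : LPA K G) => by
      change vx K G v * (vx K G v * m) = vx K G v * m
      rw [← mul_assoc, vx_mul_self])

theorem vx_mul_coe (v : V) (x : LinearMap.range (leftMul K G (vx K G v))) :
    vx K G v * (x : LPA K G) = x := by
  obtain ⟨_, y, rfl⟩ := x
  change vx K G v * (vx K G v * y) = vx K G v * y
  rw [← mul_assoc, vx_mul_self]

/-- The frame of `v L_K(E)` consisting of `v`. -/
noncomputable def vertexFrame (v : V) : PreFrame (vertexModule K G v) 0 fun _ : Unit => v where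
  b _ := ⟨vx K G v, vx K G v, vx_mul_self K G v⟩
  c _ := (LinearMap.range (leftMul K G (vx K G v))).subtype
  b_mem _ := vx_mem K G v
  c_mem _ i x hx := by
    rw [sub_zero]
    exact hx
  b_vx _ := Subtype.ext (vx_mul_self K G v)
  vx_c _ x := vx_mul_coe K G v x
  sum_eq x := by
    rw [Fintype.sum_unique]
    exact Subtype.ext (vx_mul_coe K G v x)

theorem isDual_vertexFrame (v : V) : (vertexFrame K G v).IsDual :=
  ⟨fun _ => rfl, fun _ _ h => absurd rfl h⟩

variable {K G}

/-- One copy of `L(-k)` is used for each element of `s`. -/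
theorem exists_cover (P : GrModule (grading K G)) (k : ℤ) (s : Finset P.carrier)
    (hs : ↑s ⊆ (P.deg k : Set P.carrier)) :
    ∃ (M : GrModule (grading K G)) (ι : Type u) (_ : Fintype ι) (v : ι → V)
      (_ : PreFrame M k v) (g : M.carrier →ₗ[(LPA K G)ᵐᵒᵖ] P.carrier),
      GrModule.IsGradedHom g ∧ ↑s ⊆ (LinearMap.range g : Set P.carrier) := by
  classical
  induction s using Finset.induction_on with
  | empty =>
    refine ⟨GrModule.zero _, PEmpty, inferInstance, PEmpty.elim,
      { b := fun j => j.elim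
        c := fun j => j.elim
        b_mem := fun j => j.elim
        c_mem := fun j => j.elim
        b_vx := fun j => j.elim
        vx_c := fun j => j.elim
        sum_eq := fun _ => Subsingleton.elim (α := PUnit) _ _ }, 0, ?_, by simp⟩
    exact fun i _ _ => (P.deg i).zero_mem
  | insert m s _ ih =>
    rw [Finset.coe_insert, Set.insert_subset_iff] at hs
    obtain ⟨M, ι, _, v, F, g, hg, hr⟩ := ih hs.2
    -- The shift by `-k` puts the generator `1` in degree `k`, the degree of its image `m`.
    have F₀ : PreFrame ((regular K G).shift (-k)) k (id : V → V) :=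
      (regularFrame K G).shift (neg_add_cancel k)
    let g₀ : ((regular K G).shift (-k)).carrier →ₗ[(LPA K G)ᵐᵒᵖ] P.carrier :=
      (orbitMap m : LPA K G →ₗ[(LPA K G)ᵐᵒᵖ] P.carrier)
    refine ⟨((regular K G).shift (-k)).prod M, V ⊕ ι, inferInstance, _, F₀.prod F,
      LinearMap.coprod g₀ g, fun i x hx => ?_, ?_⟩
    · refine (P.deg i).add_mem ?_ (hg i _ hx.2)
      have := P.smul_mem hs.1 hx.1
      rwa [add_neg_cancel_left] at this
    · rw [Finset.coe_insert, Set.insert_subset_iff]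
      constructor
      · refine ⟨((1 : LPA K G), 0), ?_⟩
        change m <• (1 : LPA K G) + g 0 = m
        rw [MulOpposite.op_one, one_smul, map_zero, add_zero]
      · intro x hx
        obtain ⟨y, rfl⟩ := hr hx
        refine ⟨(0, y), ?_⟩
        change g₀ 0 + g y = g y
        rw [map_zero, zero_add]

/-- Every `x` equals `∑ (x e) e*`, so `P_k` lies in the submodule generated by `P_{k+1}`. -/
theorem span_deg_mono (hG : G.NoSinks) (P : GrModule (grading K G)) :
    Monotone fun k : ℤ => Submodule.span (LPA K G)ᵐᵒᵖ (P.deg k : Set P.carrier) := by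
  refine monotone_int_of_le_succ fun k => Submodule.span_le.2 fun x hx => ?_
  have h1 : x = ∑ v, ∑ e ∈ Finset.univ.filter (fun e => G.s e = v),
      (x <• ed K G e) <• gh K G e := by
    simp only [rsmul_rsmul, ← sum_rsmul, sum_ed_mul_gh K G hG, sum_vx, MulOpposite.op_one,
      one_smul]
  rw [SetLike.mem_coe, h1]
  exact sum_mem fun v _ => sum_mem fun e _ => Submodule.smul_mem _ _
    (Submodule.subset_span (P.smul_mem hx (ed_mem K G e)))

theorem exists_span_deg_eq_top (hG : G.NoSinks) {P : GrModule (grading K G)} (hP : P.IsFG)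
    (n : ℤ) : ∃ k, n ≤ k ∧ Submodule.span (LPA K G)ᵐᵒᵖ (P.deg k : Set P.carrier) = ⊤ := by
  have hmono := span_deg_mono hG P
  have h1 (x : P.carrier) : ∃ k, x ∈ Submodule.span (LPA K G)ᵐᵒᵖ (P.deg k : Set P.carrier) := by
    obtain ⟨z, rfl⟩ := P.isInternal.2 x
    induction z using DirectSum.induction_on with
    | zero => exact ⟨0, by simp⟩
    | of i p =>
      refine ⟨i, Submodule.subset_span ?_⟩
      rw [DirectSum.coeAddMonoidHom_of]
      exact p.2
    | add y z hy hz =>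
      obtain ⟨i, hi⟩ := hy
      obtain ⟨j, hj⟩ := hz
      refine ⟨max i j, ?_⟩
      rw [map_add]
      exact add_mem (hmono (le_max_left i j) hi) (hmono (le_max_right i j) hj)
  obtain ⟨s, hs⟩ := hP.fg_top
  choose f hf using h1
  obtain ⟨k, hk⟩ := (s.image f).bddAbove
  refine ⟨max n k, le_max_left _ _, top_le_iff.1 (hs ▸ Submodule.span_le.2 fun x hx => ?_)⟩
  refine hmono ((hk ?_).trans (le_max_right n k)) (hf x)
  exact Finset.mem_coe.2 (Finset.mem_image_of_mem f hx)

/-- A finite subset of some `P_k` generates `P`; projectivity splits the resulting cover, and a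
retract inherits the pre-frame. -/
theorem exists_preFrame (hG : G.NoSinks) {P : GrModule (grading K G)} (hP : P.IsFG)
    (hP' : P.IsGradedProjective) (n : ℤ) :
    ∃ (k : ℤ) (_ : n ≤ k) (ι : Type u) (_ : Fintype ι) (v : ι → V), Nonempty (PreFrame P k v) := by
  obtain ⟨k, hk, hspan⟩ := exists_span_deg_eq_top hG hP n
  obtain ⟨s, hs, hs'⟩ := (Submodule.fg_span_iff_fg_span_finset_subset _).1
    (hspan.symm ▸ hP.fg_top)
  obtain ⟨M, ι, _, v, F, g, hg, hr⟩ := exists_cover P k s hs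
  have hsurj : Function.Surjective g := by
    rw [← LinearMap.range_eq_top, ← top_le_iff, ← hspan, hs']
    exact Submodule.span_le.2 hr
  obtain ⟨h, hh, hgh⟩ := hP' M P g LinearMap.id hg hsurj fun _ _ hm => hm
  exact ⟨k, hk, ι, _, v, ⟨F.retract g h hg hh (LinearMap.congr_fun hgh)⟩⟩

/-- The graded module `P` has a frame of degree `k` in which the vertex `u` occurs `a u` times. -/
def HasFrame (P : GrModule (grading K G)) (k : ℕ) (a : V → ℤ) : Prop :=
  ∃ (ι : Type v) (_ : Fintype ι) (v : ι → V) (F : PreFrame P k v), F.IsDual ∧ colorCount v = a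

/-- Moves the index type to the universe of `E`, where refinement can be iterated. -/
theorem PreFrame.exists_uLift {P : GrModule (grading K G)} {k : ℤ} {ι : Type y} [Fintype ι]
    {v : ι → V} (F : PreFrame P k v) : ∃ (κ : Type v) (_ : Fintype κ) (t : κ → V)
      (F' : PreFrame P k t), colorCount t = colorCount v ∧ (F.IsDual → F'.IsDual) := by
  let e : ULift.{v} (Fin (Fintype.card ι)) ≃ ι := Equiv.ulift.trans (Fintype.equivFin ι).symm
  exact ⟨_, inferInstance, v ∘ e, F.reindex e fun _ => rfl, colorCount_comp v e,
    fun h => h.reindex e _⟩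

theorem PreFrame.IsDual.hasFrame {P : GrModule (grading K G)} {k : ℕ} {ι : Type y} [Fintype ι]
    {v : ι → V} {F : PreFrame P k v} (hF : F.IsDual) : HasFrame P k (colorCount v) := by
  obtain ⟨κ, _, t, F', h, h'⟩ := F.exists_uLift
  exact ⟨κ, _, t, F', h' hF, h⟩

/-! ### Operations on frames, in terms of counts -/

namespace HasFrame

variable {P Q : GrModule (grading K G)} {k : ℕ} {a b : V → ℤ}

theorem nonneg (h : HasFrame P k a) : 0 ≤ a := by
  obtain ⟨_, _, _, _, _, rfl⟩ := h
  exact colorCount_nonneg _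

theorem succ (hG : G.NoSinks) (h : HasFrame P k a) :
    HasFrame P (k + 1) (G.adjMatrixᵀ *ᵥ a) := by
  obtain ⟨ι, _, v, F, hF, rfl⟩ := h
  rw [← colorCount_refine]
  exact ⟨_, _, _, F.refine hG, hF.refine hG, rfl⟩

theorem add (hG : G.NoSinks) (n : ℕ) (h : HasFrame P k a) :
    HasFrame P (k + n) ((G.adjMatrixᵀ ^ n) *ᵥ a) := by
  induction n with
  | zero => simpa using h
  | succ n ih =>
    rw [pow_succ', ← Matrix.mulVec_mulVec]
    exact ih.succ hG

theorem prod (h : HasFrame P k a) (h' : HasFrame Q k b) : HasFrame (P.prod Q) k (a + b) := by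
  obtain ⟨ι, _, v, F, hF, rfl⟩ := h
  obtain ⟨κ, _, t, F', hF', rfl⟩ := h'
  rw [← colorCount_sumElim]
  exact (hF.prod hF').hasFrame

theorem of_isIso (h : HasFrame P k a) (e : P.IsIso Q) : HasFrame Q k a := by
  obtain ⟨ι, _, v, F, hF, rfl⟩ := h
  obtain ⟨e, he⟩ := e
  exact ⟨ι, _, v, F.transport e he, hF.transport e he, rfl⟩

theorem isIso (h : HasFrame P k a) (h' : HasFrame Q k a) : P.IsIso Q := by
  obtain ⟨ι, _, v, F, hF, rfl⟩ := h
  obtain ⟨κ, _, t, F', hF', h⟩ := h'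
  exact PreFrame.isIso_of_colorCount_eq hF hF' h.symm

theorem shift_one (h : HasFrame P (k + 1) a) : HasFrame (P.shift 1) k a := by
  obtain ⟨ι, _, v, F, hF, rfl⟩ := h
  exact ⟨ι, _, v, F.shift (by push_cast; ring), hF.shift _, rfl⟩

theorem exists_pow_mulVec_eq (hG : G.NoSinks) (h : HasFrame P k a) (h' : HasFrame P k b) :
    ∃ n : ℕ, (G.adjMatrixᵀ ^ n) *ᵥ a = (G.adjMatrixᵀ ^ n) *ᵥ b := by
  obtain ⟨ι, _, v, F, hF, rfl⟩ := h
  obtain ⟨κ, _, t, F', hF', rfl⟩ := h'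
  exact PreFrame.exists_pow_mulVec_colorCount_eq hG hF hF'

end HasFrame

theorem exists_hasFrame (hG : G.NoSinks) {P : GrModule (grading K G)} (hP : P.IsFG)
    (hP' : P.IsGradedProjective) (n : ℕ) : ∃ k, n ≤ k ∧ ∃ a, HasFrame P k a := by
  obtain ⟨k, hk, ι, _, v, ⟨F⟩⟩ := exists_preFrame hG hP hP' n
  obtain ⟨κ, _, t, F', -, -⟩ := F.exists_uLift
  obtain ⟨N, hN⟩ := exists_isDiagAt_family (fun x : κ × κ => F'.c x.1 (F'.b x.2))
    fun x => F'.c_b_mem F' _ _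
  obtain ⟨κ', _, t', F₁, hF₁⟩ := F'.exists_isDiag_of_isDiagAt hG N fun i j => hN N le_rfl (i, j)
  obtain ⟨κ₂, _, t₂, F₂, hF₂⟩ := F₁.exists_isDual_of_isDiag hG hF₁
  -- `HasFrame` takes its degree in `ℕ`; here `0 ≤ n ≤ k`, and the degree after `N` refinements is
  -- `k + N`.
  obtain ⟨l, hl⟩ := Int.eq_ofNat_of_zero_le (show 0 ≤ k + N by omega)
  revert F₂
  rw [hl]
  intro F₂ hF₂
  exact ⟨l, by omega, _, hF₂.hasFrame⟩

theorem exists_hasFrame_single (v : V) (k : ℕ) : ∃ P : GrModule (grading K G), P.IsFG ∧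
    P.IsGradedProjective ∧ HasFrame P k (Pi.single v 1) := by
  let F := (vertexFrame K G v).shift (neg_add_cancel (k : ℤ))
  have hF : F.IsDual := isDual_vertexFrame K G v
  have hc : colorCount (fun _ : Unit => v) = Pi.single v 1 := by
    funext u
    rw [colorCount, Finset.natCast_card_filter, Pi.single_apply]
    simp [eq_comm]
  exact ⟨_, F.isFG, F.isGradedProjective, hc ▸ hF.hasFrame⟩

end LPA

/-! ### Equality in the dimension group -/

namespace KriegerGroup

variable {n : Type u} [Fintype n] [DecidableEq n] (A : Matrix n n ℤ)

theorem mk_add_pow_mulVec (k m : ℕ) (a : n → ℤ) : mk A (k + m) ((A ^ m) *ᵥ a) = mk A k a := by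
  induction m with
  | zero => simp
  | succ m ih => rw [pow_succ', ← Matrix.mulVec_mulVec, ← add_assoc, mk_succ_mulVec, ih]

instance : DirectedSystem (fun _ : ℕ => n → ℤ) fun i j h => stationaryMap A i j h where
  map_self i a := by
    change (A ^ (i - i)) *ᵥ a = a
    simp
  map_map k j i hij hjk a := by
    change (A ^ (k - j)) *ᵥ ((A ^ (j - i)) *ᵥ a) = (A ^ (k - i)) *ᵥ a
    rw [Matrix.mulVec_mulVec, ← pow_add, Nat.sub_add_sub_cancel hjk hij]

/-- An element that vanishes in a direct limit vanishes at a finite stage. -/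
theorem exists_pow_mulVec_eq {k : ℕ} {a b : n → ℤ} (h : mk A k a = mk A k b) :
    ∃ m : ℕ, (A ^ m) *ᵥ a = (A ^ m) *ᵥ b := by
  have h0 : mk A k (a - b) = 0 := by rw [map_sub, h, sub_self]
  obtain ⟨j, hj, h1⟩ := AddCommGroup.DirectLimit.of.zero_exact
    (G := fun _ : ℕ => n → ℤ) (f := stationaryMap A) k (a - b) h0
  refine ⟨j - k, sub_eq_zero.1 ?_⟩
  rw [← Matrix.mulVec_sub]
  exact h1

end KriegerGroup

namespace LPA

variable {V : Type u} {E : Type v} [Fintype V] [Fintype E] [DecidableEq V]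
variable {K : Type w} [Field K] {G : DirectedGraph V E}

/-! ### The class of a graded module in Krieger's dimension group -/

/-- Both frames are refined to the common degree `k + l`, where uniqueness of counts up to a power
of `A^t` applies. -/
theorem HasFrame.mk_eq_mk (hG : G.NoSinks) {P : GrModule (grading K G)} {k l : ℕ} {a b : V → ℤ}
    (h : HasFrame P k a) (h' : HasFrame P l b) :
    KriegerGroup.mk G.adjMatrixᵀ k a = KriegerGroup.mk G.adjMatrixᵀ l b := by
  obtain ⟨m, hm⟩ := (h.add hG l).exists_pow_mulVec_eq hG (add_comm l k ▸ h'.add hG k)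
  rw [← KriegerGroup.mk_add_pow_mulVec _ k l, ← KriegerGroup.mk_add_pow_mulVec _ l k,
    ← KriegerGroup.mk_add_pow_mulVec _ (k + l) m, hm, add_comm l k,
    KriegerGroup.mk_add_pow_mulVec _ (k + l) m]

/-- Equality in the limit means that finitely many further refinements give both modules frames of
the same degree and count. -/
theorem HasFrame.isIso_of_mk_eq_mk (hG : G.NoSinks) {P Q : GrModule (grading K G)} {k l : ℕ}
    {a b : V → ℤ} (h : HasFrame P k a) (h' : HasFrame Q l b)
    (hab : KriegerGroup.mk G.adjMatrixᵀ k a = KriegerGroup.mk G.adjMatrixᵀ l b) : P.IsIso Q := by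
  rw [← KriegerGroup.mk_add_pow_mulVec _ k l, ← KriegerGroup.mk_add_pow_mulVec _ l k,
    add_comm l k] at hab
  obtain ⟨m, hm⟩ := KriegerGroup.exists_pow_mulVec_eq _ hab
  have h1 := (h.add hG l).add hG m
  rw [hm] at h1
  exact h1.isIso ((add_comm l k ▸ h'.add hG k : HasFrame Q (k + l) _).add hG m)

theorem exists_krieger_class (hG : G.NoSinks) (P : PgrModule (grading K G)) :
    ∃ z, ∀ k a, HasFrame P.1 k a → KriegerGroup.mk G.adjMatrixᵀ k a = z := by
  obtain ⟨k, -, a, h⟩ := exists_hasFrame hG P.2.1 P.2.2 0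
  exact ⟨_, fun _ _ h' => h'.mk_eq_mk hG h⟩

/-- The class in Krieger's dimension group of a graded finitely generated projective module. -/
noncomputable def kriegerClass (hG : G.NoSinks) (P : PgrModule (grading K G)) :
    KriegerGroup G.adjMatrixᵀ :=
  (exists_krieger_class hG P).choose

theorem HasFrame.kriegerClass_eq (hG : G.NoSinks) {P : PgrModule (grading K G)} {k : ℕ}
    {a : V → ℤ} (h : HasFrame P.1 k a) :
    kriegerClass hG P = KriegerGroup.mk G.adjMatrixᵀ k a :=
  ((exists_krieger_class hG P).choose_spec k a h).symm

theorem kriegerClass_eq_iff (hG : G.NoSinks) (P Q : PgrModule (grading K G)) :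
    kriegerClass hG P = kriegerClass hG Q ↔ P.1.IsIso Q.1 := by
  obtain ⟨k, -, a, h⟩ := exists_hasFrame hG P.2.1 P.2.2 0
  obtain ⟨l, -, b, h'⟩ := exists_hasFrame hG Q.2.1 Q.2.2 0
  constructor
  · intro hPQ
    rw [h.kriegerClass_eq hG, h'.kriegerClass_eq hG] at hPQ
    exact h.isIso_of_mk_eq_mk hG h' hPQ
  · intro e
    rw [h.kriegerClass_eq hG, (h.of_isIso e).kriegerClass_eq hG]

theorem kriegerClass_prod (hG : G.NoSinks) (P Q : PgrModule (grading K G)) :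
    kriegerClass hG ⟨P.1.prod Q.1, P.2.1.prod Q.2.1, P.2.2.prod Q.2.2⟩ =
      kriegerClass hG P + kriegerClass hG Q := by
  obtain ⟨k, -, a, h⟩ := exists_hasFrame hG P.2.1 P.2.2 0
  obtain ⟨l, -, b, h'⟩ := exists_hasFrame hG Q.2.1 Q.2.2 0
  have h1 := h.add hG l
  have h2 : HasFrame Q.1 (k + l) _ := add_comm l k ▸ h'.add hG k
  rw [h1.kriegerClass_eq hG, h2.kriegerClass_eq hG, ← map_add]
  exact HasFrame.kriegerClass_eq hG (h1.prod h2)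

theorem kriegerClass_shift_one (hG : G.NoSinks) (P : PgrModule (grading K G)) :
    kriegerClass hG ⟨P.1.shift 1, P.2.1.shift 1, P.2.2.shift 1⟩ =
      KriegerGroup.delta G.adjMatrixᵀ (kriegerClass hG P) := by
  -- Degree at least `1` leaves room to shift down: a frame of degree `l + 1` of `P` is one of
  -- degree `l` of `P(1)`, and `[a, l] = [A^t a, l + 1] = δ [a, l + 1]`.
  obtain ⟨k, hk, a, h⟩ := exists_hasFrame hG P.2.1 P.2.2 1
  obtain ⟨l, rfl⟩ := Nat.exists_eq_add_of_le' hk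
  rw [h.kriegerClass_eq hG]
  refine (HasFrame.kriegerClass_eq hG h.shift_one).trans ?_
  exact (KriegerGroup.mk_succ_mulVec _ l a).symm.trans (KriegerGroup.deltaHom_mk _ _ _).symm

/-- The map from `𝒱^gr(L_K(E))` to Krieger's dimension group. -/
noncomputable def vgrToKrieger (hG : G.NoSinks) :
    Vgr (grading K G) →+ KriegerGroup G.adjMatrixᵀ :=
  AddMonoidHom.mk' (Quotient.lift (kriegerClass hG) fun P Q h => (kriegerClass_eq_iff hG P Q).2 h)
    (by
      rintro ⟨P⟩ ⟨Q⟩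
      exact kriegerClass_prod hG P Q)

theorem vgrToKrieger_mk (hG : G.NoSinks) (P : PgrModule (grading K G)) :
    vgrToKrieger hG (Vgr.mk P) = kriegerClass hG P := rfl

theorem vgrToKrieger_injective (hG : G.NoSinks) :
    Function.Injective (vgrToKrieger (K := K) hG) := by
  rintro ⟨P⟩ ⟨Q⟩ h
  exact Vgr.sound ((kriegerClass_eq_iff hG P Q).1 h)

/-- A nonnegative vector is a sum of unit vectors, and `[e_v, k]` is the class of `(v L)(-k)`. -/
theorem range_vgrToKrieger (hG : G.NoSinks) :
    Set.range (vgrToKrieger (K := K) hG) = KriegerGroup.posCone G.adjMatrixᵀ := by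
  ext z
  constructor
  · rintro ⟨⟨P⟩, rfl⟩
    obtain ⟨k, -, a, h⟩ := exists_hasFrame hG P.2.1 P.2.2 0
    exact ⟨k, a, h.nonneg, h.kriegerClass_eq hG⟩
  · rintro ⟨k, a, ha, rfl⟩
    have h1 (v : V) : KriegerGroup.mk G.adjMatrixᵀ k (Pi.single v 1) ∈
        AddMonoidHom.mrange (vgrToKrieger (K := K) hG) := by
      obtain ⟨P, hP, hP', h⟩ := exists_hasFrame_single (K := K) (G := G) v k
      exact ⟨Vgr.mk ⟨P, hP, hP'⟩, HasFrame.kriegerClass_eq hG h⟩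
    have h2 : a = ∑ v, (a v).toNat • (Pi.single v 1 : V → ℤ) := by
      funext w
      simpa [Finset.sum_apply, Pi.single_apply] using ha w
    change _ ∈ AddMonoidHom.mrange (vgrToKrieger (K := K) hG)
    rw [h2, map_sum]
    refine sum_mem fun v _ => ?_
    rw [map_nsmul]
    exact nsmul_mem (h1 v) _

/-- The map from `K₀^gr(L_K(E))` to Krieger's dimension group. -/
noncomputable def k0grToKrieger (hG : G.NoSinks) :
    K0gr (grading K G) →+ KriegerGroup G.adjMatrixᵀ :=
  Algebra.GrothendieckAddGroup.lift (vgrToKrieger hG)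

theorem k0grToKrieger_of (hG : G.NoSinks) (p : Vgr (grading K G)) :
    k0grToKrieger hG (K0gr.of p) = vgrToKrieger hG p :=
  DFunLike.congr_fun (Algebra.GrothendieckAddGroup.lift.symm_apply_apply (vgrToKrieger hG)) p

/-- An element `[p] - [q]` of the kernel has `p` and `q` with equal images, hence `p = q` already in
the monoid. -/
theorem k0grToKrieger_injective (hG : G.NoSinks) :
    Function.Injective (k0grToKrieger (K := K) hG) := by
  refine (injective_iff_map_eq_zero _).2 fun z hz => ?_
  obtain ⟨⟨p, q, _⟩, hpq : z + K0gr.of q = K0gr.of p⟩ :=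
    (AddLocalization.addMonoidOf (⊤ : AddSubmonoid (Vgr (grading K G)))).surj z
  have h := congrArg (k0grToKrieger hG) hpq
  rw [map_add, hz, zero_add, k0grToKrieger_of, k0grToKrieger_of] at h
  rw [vgrToKrieger_injective hG h] at hpq
  exact add_eq_right.1 hpq

theorem k0grToKrieger_surjective (hG : G.NoSinks) :
    Function.Surjective (k0grToKrieger (K := K) hG) := by
  intro z
  induction z using AddCommGroup.DirectLimit.induction_on with
  | ih k a =>
    have h (b : V → ℤ) (hb : 0 ≤ b) :
        ∃ p, vgrToKrieger (K := K) hG p = KriegerGroup.mk G.adjMatrixᵀ k b := by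
      have : KriegerGroup.mk G.adjMatrixᵀ k b ∈ Set.range (vgrToKrieger (K := K) hG) := by
        rw [range_vgrToKrieger]
        exact ⟨k, b, hb, rfl⟩
      exact this
    obtain ⟨p, hp⟩ := h a⁺ (posPart_nonneg a)
    obtain ⟨q, hq⟩ := h a⁻ (negPart_nonneg a)
    refine ⟨K0gr.of p - K0gr.of q, ?_⟩
    rw [map_sub, k0grToKrieger_of, k0grToKrieger_of, hp, hq, ← map_sub, posPart_sub_negPart]
    rfl

theorem k0grToKrieger_T_smul (hG : G.NoSinks) (α : K0gr (grading K G)) :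
    k0grToKrieger hG ((LaurentPolynomial.T 1 : ℤ[T;T⁻¹]) • α) =
      KriegerGroup.delta G.adjMatrixᵀ (k0grToKrieger hG α) := by
  have h : (k0grToKrieger hG).comp
      (DistribSMul.toAddMonoidHom (K0gr (grading K G)) (LaurentPolynomial.T 1 : ℤ[T;T⁻¹])) =
      (KriegerGroup.delta G.adjMatrixᵀ).toAddMonoidHom.comp (k0grToKrieger hG) := by
    refine K0gr.hom_ext ?_
    rintro ⟨P⟩
    change k0grToKrieger hG ((AddMonoidAlgebra.single 1 1 : AddMonoidAlgebra ℤ ℤ) •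
      K0gr.of (Vgr.mk P)) = KriegerGroup.delta _ (k0grToKrieger hG (K0gr.of (Vgr.mk P)))
    rw [K0gr.single_smul_of_mk, k0grToKrieger_of, k0grToKrieger_of, vgrToKrieger_mk]
    exact kriegerClass_shift_one hG P
  exact DFunLike.congr_fun h α

theorem image_k0grToKrieger_posCone (hG : G.NoSinks) :
    k0grToKrieger hG '' K0gr.posCone (grading K G) = KriegerGroup.posCone G.adjMatrixᵀ := by
  rw [K0gr.posCone, ← Set.range_comp, ← range_vgrToKrieger (K := K) hG]
  exact congrArg Set.range (funext (k0grToKrieger_of hG))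

end LPA

theorem mainTheorem7 {V : Type u} {E : Type v} [Fintype V] [Fintype E] [DecidableEq V]
    (G : DirectedGraph V E) (hG : G.NoSinks) (K : Type w) [Field K] :
    ∃ φ : K0gr (LPA.grading K G) ≃+ KriegerGroup (G.adjMatrixᵀ),
      (∀ α : K0gr (LPA.grading K G),
        φ ((LaurentPolynomial.T 1 : ℤ[T;T⁻¹]) • α) = KriegerGroup.delta (G.adjMatrixᵀ) (φ α)) ∧
      φ '' K0gr.posCone (LPA.grading K G) = KriegerGroup.posCone (G.adjMatrixᵀ) :=
  ⟨AddEquiv.ofBijective (LPA.k0grToKrieger hG)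
    ⟨LPA.k0grToKrieger_injective hG, LPA.k0grToKrieger_surjective hG⟩,
    LPA.k0grToKrieger_T_smul hG, LPA.image_k0grToKrieger_posCone hG⟩
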